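/- Let $m\ge 1$ and order the letters $1<2<\cdots<m<\overline m<\cdots<\overline 2<\overline 1$. A strictly increasing column $C$ of such letters is *admissible* if, whenever $i$ and $\overline i$ both occur in $C$, with $i$ in the $p$-th box from the top and $\overline i$ in the $q$-th box from the bottom, one has $p+q\le i$. For an admissible column $C$ let $z_1>\cdots>z_r$ be the $z\in\{1,\dots,m\}$ such that $z$ and $\overline z$ both occur in $C$; successively for $k=1,\dots,r$ let $t_k$ be the greatest element of $\{1,\dots,m\}$ with $t_k<z_k$, $t_k<t_{k-1}$ (if $k>1$), and $t_k,\overline{t_k}\notin C$ (these exist because $C$ is admissible). Let $\ell C$ (respectively $rC$) be the column obtained from $C$ by replacing each $z_k$ by $t_k$ (respectively each $\overline{z_k}$ by $\overline{t_k}$) and reordering. For partitions $\mu\subseteq\lambda$, let $SP(\lambda/\mu,2m)$ be the set of Kashiwara–Nakashima skew symplectic tableaux of shape $\lambda/\mu$: the fillings of the boxes of $\lambda/\mu$ with these letters such that every column is strictly increasing from top to bottom and admissible, and the split form, obtained by replacing each column $C$ by the two columns $\ell C\; rC$, is semistandard (rows weakly increasing from left to right, columns strictly increasing from top to bottom). For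 $T\in SP(\lambda/\mu,2m)$ let $a_i$ and $a_{\overline i}$ be the numbers of entries of $T$ equal to $i$ and to $\overline i$, and put $$\mathrm{pwr}(T)=\sum_{i=1}^m\bigl((i-1)a_i+(2m-i)a_{\overline i}\bigr),\qquad X(q)=\sum_{T\in SP(\lambda/\mu,2m)}q^{\mathrm{pwr}(T)}.$$ **Theorem.** Let $|\lambda/\mu|=n$ be odd, and suppose that $\gcd(m,p)=1$ for every odd prime $p\le n$. Then $2m$ divides $|SP(\lambda/\mu,2m)|$, and $$X(q)\equiv\frac{|SP(\lambda/\mu,2m)|}{2m}\sum_{k=0}^{2m-1}q^k \pmod{q^{2m}-1}\quad\text{in }\mathbb Z[q].$$ -/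

import Mathlib

namespace SymplecticTableaux

open Finset Polynomial

/-- The alphabet `1 < 2 < ⋯ < m < m̄ < ⋯ < 2̄ < 1̄`, listed in increasing order: the letter `i`
(`1 ≤ i ≤ m`) is the element `i - 1` of `Fin (2 * m)`, and `ī` is the element `2 * m - i`. -/
abbrev Letter (m : ℕ) : Type := Fin (2 * m)

/-- The unbarred letter numbered `i`, with `i : Fin m` counted from `0`
(so this is the letter written `i + 1` when counting from `1`). -/
def unbarred {m : ℕ} (i : Fin m) : Letter m := ⟨i, by have := i.isLt; omega⟩

/-- The barred letter numbered `i`, with `i : Fin m` counted from `0`. -/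
def barred {m : ℕ} (i : Fin m) : Letter m := ⟨2 * m - 1 - i, by have := i.isLt; omega⟩

/-- The boxes of the skew shape `lam / mu`; a box is a pair `(row, column)`, rows counted from top
to bottom, columns from left to right. -/
def skewCells (lam mu : YoungDiagram) : Finset (ℕ × ℕ) := lam.cells \ mu.cells

/-- Fillings of the boxes of `lam / mu` with letters. -/
abbrev Filling (lam mu : YoungDiagram) (m : ℕ) : Type := ↥(skewCells lam mu) → Letter m

/-- The set of letters in column `j`. When columns are strictly increasing, this set determines
the column. -/
def column {lam mu : YoungDiagram} {m : ℕ} (T : Filling lam mu m) (j : ℕ) : Finset (Letter m) :=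
  univ.filter fun a => ∃ c : ↥(skewCells lam mu), c.1.2 = j ∧ T c = a

/-- Entries strictly increase down each column. -/
def ColStrict {lam mu : YoungDiagram} {m : ℕ} (T : Filling lam mu m) : Prop :=
  ∀ c d : ↥(skewCells lam mu), c.1.2 = d.1.2 → c.1.1 < d.1.1 → T c < T d

/-- The one-column condition for the strictly increasing column with set of letters `C`: if `i` and
`ī` both occur, `i` in the `p`-th box from the top and `ī` in the `q`-th box from the bottom, then
`p + q ≤ i`. (Here `i : Fin m` is counted from `0`, whence the `+ 1`.) -/
def Admissible {m : ℕ} (C : Finset (Letter m)) : Prop :=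
  ∀ i : Fin m, unbarred i ∈ C → barred i ∈ C →
    (C.filter fun x => x ≤ unbarred i).card + (C.filter fun x => barred i ≤ x).card ≤ (i : ℕ) + 1

/-- The set of `z` such that both `z` and `z̄` occur in `C`. -/
def pairs {m : ℕ} (C : Finset (Letter m)) : Finset (Fin m) :=
  univ.filter fun z => unbarred z ∈ C ∧ barred z ∈ C

/-- `D` and `E` are the left column `ℓC` and the right column `rC` of the splitting of the column
`C`. Let `z₁ > z₂ > ⋯ > z_r` be the `z` such that `z` and `z̄` both occur in `C`. Successively for
`k = 1, …, r`, let `t_k = t z_k` be the greatest letter with `t_k < z_k`, with `t_k < t_l` for all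
`l < k`, and such that neither `t_k` nor its barred version occurs in `C`. Then `ℓC` is obtained
from `C` by replacing each `z_k` with `t_k`, and `rC` by replacing each `z̄_k` with `t̄_k`
(and reordering). -/
def IsSplit {m : ℕ} (C D E : Finset (Letter m)) : Prop :=
  ∃ t : Fin m → Fin m,
    (∀ z ∈ pairs C,
      IsGreatest {s : Fin m | s < z ∧ (∀ y ∈ pairs C, z < y → s < t y) ∧
        unbarred s ∉ C ∧ barred s ∉ C} (t z)) ∧
    D = (C \ (pairs C).image unbarred) ∪ (pairs C).image (fun z => unbarred (t z)) ∧
    E = (C \ (pairs C).image barred) ∪ (pairs C).image (fun z => barred (t z))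

/-- Kashiwara–Nakashima skew symplectic tableaux: the columns are strictly increasing and
admissible, and the split form is semistandard. The split form is obtained by replacing each column
`C` by the two columns `ℓC rC`; here `L` and `R` are the fillings of `lam / mu` by the columns
`ℓC` and by the columns `rC` respectively. -/
def IsKN {lam mu : YoungDiagram} {m : ℕ} (T : Filling lam mu m) : Prop :=
  ColStrict T ∧ (∀ j, Admissible (column T j)) ∧
  ∃ L R : Filling lam mu m, ColStrict L ∧ ColStrict R ∧
    (∀ j, IsSplit (column T j) (column L j) (column R j)) ∧
    (∀ c, L c ≤ R c) ∧
    (∀ c d : ↥(skewCells lam mu), c.1.1 = d.1.1 → d.1.2 = c.1.2 + 1 → R c ≤ L d)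

open Classical in
/-- `SP(lam / mu, 2m)`. -/
noncomputable def SP (lam mu : YoungDiagram) (m : ℕ) : Finset (Filling lam mu m) :=
  univ.filter fun T => IsKN T

/-- The number of occurrences of the letter `a` in `T`. -/
def count {lam mu : YoungDiagram} {m : ℕ} (T : Filling lam mu m) (a : Letter m) : ℕ :=
  (univ.filter fun c => T c = a).card

/-- `pwr(T) = ∑_{i=1}^m ((i - 1) a_i + (2m - i) a_ī)`, where `a_i`, `a_ī` are the numbers of
occurrences of `i`, `ī` in `T`. (The index below is `i - 1`.) -/
def pwr {lam mu : YoungDiagram} {m : ℕ} (T : Filling lam mu m) : ℕ :=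
  ∑ i : Fin m, ((i : ℕ) * count T (unbarred i) + (2 * m - ((i : ℕ) + 1)) * count T (barred i))

/-- The polynomial `X(q) = ∑_{T ∈ SP(lam / mu, 2m)} q ^ pwr(T)`. -/
noncomputable def genPoly (lam mu : YoungDiagram) (m : ℕ) : ℤ[X] :=
  ∑ T ∈ SP lam mu m, X ^ pwr T

end SymplecticTableaux

/-!
The entry at position `a = 0, …, 2m - 1` of the ordered alphabet contributes `a` to `pwr`. If
`ω ^ (2m) = 1` and `ζ ^ 2 = ω`, then `ω ^ a = ζ⁻¹ * ζ ^ (2a + 1)`, and `ζ ^ (2a + 1)` is the value of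
the letter `a` when the letter `v` (counted from `0`) has the value `x_v = ζ ^ (2v + 1)` and `v̄` has
the value `x_v⁻¹`. Hence `X(ω)` is, up to a power of `ζ`, the character
`∑ T, ∏ x_v ^ (a_v - a_v̄)` at this point. By orthogonality of characters of `ℤ / 2m`
(`mul_card_filter_eq_card`) it is enough that this vanishes for `ω ≠ 1`, for then `pwr` is
equidistributed modulo `2m`.

The character is invariant under the hyperoctahedral group (permutations and inversions of the
`x_v`), so it is a combination of orbit sums of monomials whose degree is odd and at most `n`. Such
an orbit sum is a polynomial in the power sums `∑ v, (x_v ^ k + x_v ^ (-k))`, each term of which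
involves an odd `k ≤ n` (`permSum_eq_zero`). At the point above the power sum of degree `k` is a
multiple of `∑_{a < 2m} ω ^ (k a)`, which vanishes unless `ω ^ k = 1`; for odd `k ≤ n` this would give
an odd prime `p ≤ n` dividing `m` (`pow_ne_one_of_odd`).

The heart of the matter is the invariance of the character. The pair `(ℓC, rC)` of a column is
encoded by a word of `m` steps, one for each index `v`: the letters `t_k` and `z_k` become opening
and closing brackets, and the words which occur are exactly the balanced ones in which an index not
occurring in the split column lies outside all brackets (`Balanced.isSplit`,
`IsSplit.exists_balanced`). A tableau is thus a path of states, a state recording how many unbarred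
and barred letters of small index each `ℓC` and `rC` contains; semistandardness is a condition on
each state. The generating function is an iterated transfer operator, and the simple reflections
become the identities `transfer_comm` and `transfer_finalValue_inv`. Both are local: between two
fixed states the intermediate states consist of independent choices in the columns, subject to
"up on the right implies up on the left" along some links between adjacent columns. By
inclusion-exclusion over the violated links (`sum_chain_eq`), the symmetry follows from the symmetry
of each single column, which is a finite check.
-/

namespace SymplecticTableaux

open Finset

/-! ### Sums over families with chain conditions -/

section Chain

variable {K Ω : Type*} [Field K] [Fintype Ω] {n : ℕ}

open Classical in
/-- Inclusion-exclusion over the set `V` of violated links. Once `V` is fixed, the sum over all families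
`ω` factors over the positions `j`. -/
theorem sum_chain_expand (link : Fin n → Prop) (up dn : Ω → Prop) (g : Fin (n + 1) → Ω → K) :
    (∑ ω : Fin (n + 1) → Ω, if ∀ i : Fin n, ¬ (link i ∧ dn (ω i.castSucc) ∧ up (ω i.succ))
      then ∏ j, g j (ω j) else 0) =
    ∑ V : Finset (Fin n), (∏ i ∈ V, if link i then (-1 : K) else 0) *
      ∏ j, ∑ a, if (j ∈ V.image Fin.succ → up a) ∧ (j ∈ V.image Fin.castSucc → dn a)
        then g j a else 0 := by
  have h1 : ∀ ω : Fin (n + 1) → Ω,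
      (if ∀ i : Fin n, ¬ (link i ∧ dn (ω i.castSucc) ∧ up (ω i.succ))
        then ∏ j, g j (ω j) else 0) =
      ∑ V : Finset (Fin n), (∏ i ∈ V, if link i then (-1 : K) else 0) *
        ∏ j, if (j ∈ V.image Fin.succ → up (ω j)) ∧ (j ∈ V.image Fin.castSucc → dn (ω j))
          then g j (ω j) else 0 := by
    intro ω
    have h2 : (if ∀ i : Fin n, ¬ (link i ∧ dn (ω i.castSucc) ∧ up (ω i.succ))
        then ∏ j, g j (ω j) else 0) =
        (∏ i : Fin n, ((if link i ∧ dn (ω i.castSucc) ∧ up (ω i.succ) then (-1 : K) else 0) + 1)) *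
          ∏ j, g j (ω j) := by
      split_ifs with h
      · have h3 : (∏ i : Fin n,
            ((if link i ∧ dn (ω i.castSucc) ∧ up (ω i.succ) then (-1 : K) else 0) + 1)) = 1 :=
          prod_eq_one fun i _ => by rw [if_neg (h i), zero_add]
        rw [h3, one_mul]
      · push Not at h
        obtain ⟨i, hi⟩ := h
        rw [prod_eq_zero (mem_univ i), zero_mul]
        rw [if_pos hi]
        ring
    rw [h2, prod_add, sum_mul, powerset_univ]
    refine sum_congr rfl fun V _ => ?_
    rw [prod_const_one, mul_one]
    by_cases hV : ∀ i ∈ V, dn (ω i.castSucc) ∧ up (ω i.succ)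
    · congr 1
      · refine prod_congr rfl fun i hi => ?_
        simp [hV i hi]
      · refine prod_congr rfl fun j _ => ?_
        rw [if_pos]
        simp only [mem_image]
        exact ⟨by rintro ⟨i, hi, rfl⟩; exact (hV i hi).2, by rintro ⟨i, hi, rfl⟩; exact (hV i hi).1⟩
    · push Not at hV
      obtain ⟨i, hi, hbad⟩ := hV
      rw [prod_eq_zero hi, zero_mul]
      · by_cases hd : dn (ω i.castSucc)
        · rw [prod_eq_zero (mem_univ i.succ), mul_zero]
          rw [if_neg]
          exact fun h => hbad hd (h.1 (mem_image_of_mem _ hi))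
        · rw [prod_eq_zero (mem_univ i.castSucc), mul_zero]
          rw [if_neg]
          exact fun h => hd (h.2 (mem_image_of_mem _ hi))
      · rw [if_neg]
        exact fun h => hbad h.2.1 h.2.2
  simp only [h1]
  rw [sum_comm]
  refine sum_congr rfl fun V _ => ?_
  rw [← mul_sum]
  congr 1
  rw [prod_univ_sum, Fintype.piFinset_univ]

open Classical in
/-- Two weighted sums over families `ω`, subject to the chain conditions "not both `dn (ω i)` and
`up (ω (i + 1))` when `i` is linked to `i + 1`", agree as soon as all the one-position sums with `up`
and/or `dn` prescribed agree up to factors `e` (for `up`) and `c` (for `dn`). In the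
inclusion-exclusion formula each violated link pins one `dn` and one `up`, so these factors only
enter through powers of `c * e`. -/
theorem sum_chain_eq (link : Fin n → Prop) (up dn : Ω → Prop) (g g' : Fin (n + 1) → Ω → K)
    {c e c' e' : K} (hce : c * e = c' * e') (h0 : c * e ≠ 0)
    (H : ∀ (j : Fin (n + 1)) (α β : Bool),
      (∑ a, if (α = true → up a) ∧ (β = true → dn a) then
        (if α then e else 1) * (if β then c else 1) * g j a else 0) =
      ∑ a, if (α = true → up a) ∧ (β = true → dn a) then
        (if α then e' else 1) * (if β then c' else 1) * g' j a else 0) :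
    (∑ ω : Fin (n + 1) → Ω, if ∀ i : Fin n, ¬ (link i ∧ dn (ω i.castSucc) ∧ up (ω i.succ))
      then ∏ j, g j (ω j) else 0) =
    ∑ ω : Fin (n + 1) → Ω, if ∀ i : Fin n, ¬ (link i ∧ dn (ω i.castSucc) ∧ up (ω i.succ))
      then ∏ j, g' j (ω j) else 0 := by
  have pull : ∀ (V : Finset (Fin n)) (c e : K) (g : Fin (n + 1) → Ω → K),
      (∏ j, ∑ a, if (j ∈ V.image Fin.succ → up a) ∧ (j ∈ V.image Fin.castSucc → dn a) then
        (if j ∈ V.image Fin.succ then e else 1) * (if j ∈ V.image Fin.castSucc then c else 1) *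
          g j a else 0) =
      (c * e) ^ V.card * ∏ j, ∑ a,
        if (j ∈ V.image Fin.succ → up a) ∧ (j ∈ V.image Fin.castSucc → dn a)
          then g j a else 0 := by
    intro V c e g
    have h1 : ∀ j : Fin (n + 1), (∑ a,
        if (j ∈ V.image Fin.succ → up a) ∧ (j ∈ V.image Fin.castSucc → dn a) then
        (if j ∈ V.image Fin.succ then e else 1) * (if j ∈ V.image Fin.castSucc then c else 1) *
          g j a else 0) =
        (if j ∈ V.image Fin.succ then e else 1) * (if j ∈ V.image Fin.castSucc then c else 1) *
        ∑ a, if (j ∈ V.image Fin.succ → up a) ∧ (j ∈ V.image Fin.castSucc → dn a)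
          then g j a else 0 := by
      intro j
      rw [mul_sum]
      refine sum_congr rfl fun a _ => ?_
      split_ifs <;> simp
    simp only [h1]
    rw [prod_mul_distrib, prod_mul_distrib]
    congr 1
    rw [prod_ite_mem, prod_ite_mem, univ_inter, univ_inter, prod_const, prod_const,
      card_image_of_injective _ (Fin.succ_injective n),
      card_image_of_injective _ (Fin.castSucc_injective n), mul_pow, mul_comm]
  rw [sum_chain_expand, sum_chain_expand]
  refine sum_congr rfl fun V _ => ?_
  congr 1
  have h0' : (c * e) ^ V.card ≠ 0 := pow_ne_zero _ h0
  apply mul_left_cancel₀ h0'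
  conv_rhs => rw [hce]
  rw [← pull, ← pull]
  refine prod_congr rfl fun j _ => ?_
  have := H j (decide (j ∈ V.image Fin.succ)) (decide (j ∈ V.image Fin.castSucc))
  simpa only [decide_eq_true_eq] using this

end Chain

/-! ### Steps, states and transfer operators -/

/-- How the pair `v`, `v̄` meets a split column `(C, ℓC, rC)`.
`pos`: `v` is in all three sets; `neg`: `v̄` is in all three; `none`: neither letter occurs;
`opn`: `v` is one of the letters `t_k`, so that `v ∈ ℓC` and `v̄ ∈ rC`, but neither is in `C`;
`cls`: `v` is one of the letters `z_k`, so that `v, v̄ ∈ C`, `v̄ ∈ ℓC` and `v ∈ rC`. -/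
inductive Step
  | pos
  | neg
  | none
  | opn
  | cls
  deriving DecidableEq

namespace Step

instance : Fintype Step :=
  ⟨{pos, neg, none, opn, cls}, fun a => by cases a <;> decide⟩

/-- The sign with which `v` occurs in `ℓC`: `1` for `v`, `-1` for `v̄`. -/
def left : Step → SignType
  | pos => 1
  | neg => -1
  | none => 0
  | opn => 1
  | cls => -1

/-- The sign with which `v` occurs in `rC`: `1` for `v`, `-1` for `v̄`. -/
def right : Step → SignType
  | pos => 1
  | neg => -1
  | none => 0
  | opn => -1
  | cls => 1

/-- The exponent of `x_v` contributed by the occurrences of `v` and `v̄` in `C`. -/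
def wt : Step → ℤ
  | pos => 1
  | neg => -1
  | none => 0
  | opn => 0
  | cls => 0

/-- The numbers of unbarred and of barred letters that a sign stands for. -/
def signVec : SignType → ℤ × ℤ
  | .pos => (1, 0)
  | .neg => (0, 1)
  | .zero => (0, 0)

/-- The change of the state of one column caused by a step. -/
def disp (a : Step) : (ℤ × ℤ) × (ℤ × ℤ) := (signVec a.left, signVec a.right)

end Step

/-- For each of `n + 1` columns, the numbers `((unbarred, barred) in ℓC, (unbarred, barred) in rC)` of
letters whose index is below a given level. They take integer values so that differences make sense. -/
abbrev State (n : ℕ) : Type := Fin (n + 1) → (ℤ × ℤ) × (ℤ × ℤ)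

/-- The states that can occur in a tableau: `ℓC ≤ rC` in each column (`height`), and `rC ≤ ℓC'` for
adjacent columns `C`, `C'`, expressed through counts of unbarred and of barred letters.
Here `δ i` is the vertical offset of column `i` against column `i + 1` at the top, and `δ' i` the
offset at the bottom. -/
structure Good {n : ℕ} (δ δ' : Fin n → ℤ) (σ : State n) : Prop where
  height : ∀ j, (σ j).2.1 ≤ (σ j).1.1
  unbar : ∀ i : Fin n, (σ i.succ).1.1 ≤ (σ i.castSucc).2.1 + δ i
  bar : ∀ i : Fin n, (σ i.castSucc).2.2 ≤ (σ i.succ).1.2 + δ' i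

/-- The state after one step in every column. -/
def State.next {n : ℕ} (σ : State n) (a : Fin (n + 1) → Step) : State n :=
  fun j => σ j + (a j).disp

/-- The step `a` is allowed from `σ`: it connects good states, and a column without `v` and `v̄` has as
many letters `z_k` as letters `t_k` below `v` (otherwise the splitting would have used `v`). -/
structure Allowed {n : ℕ} (δ δ' : Fin n → ℤ) (σ : State n) (a : Fin (n + 1) → Step) : Prop where
  source : Good δ δ' σ
  target : Good δ δ' (σ.next a)
  none_height : ∀ j, a j = Step.none → (σ j).1.1 = (σ j).2.1

/-- The state of complete columns of heights `k j`. -/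
structure Final {n : ℕ} (k : Fin (n + 1) → ℤ) (σ : State n) : Prop where
  eq : ∀ j, (σ j).2 = (σ j).1
  sum : ∀ j, (σ j).1.1 + (σ j).1.2 = k j

open Classical in
/-- The transfer operator: it adds one index `v`, in all columns at once, with variable `x`. -/
noncomputable def transfer {n : ℕ} (δ δ' : Fin n → ℤ) (x : ℂˣ) (V : State n → ℂ) :
    State n → ℂ :=
  fun σ => ∑ a : Fin (n + 1) → Step,
    if Allowed δ δ' σ a then (∏ j, ((x ^ (a j).wt : ℂˣ) : ℂ)) * V (σ.next a) else 0

open Classical in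
/-- The indicator function of the final states. -/
noncomputable def finalValue {n : ℕ} (k : Fin (n + 1) → ℤ) (σ : State n) : ℂ :=
  if Final k σ then 1 else 0

/-- The conditions on two consecutive steps `ω` in one column with total displacement `d`, starting
from a state with `#unbarred in ℓC - #unbarred in rC = h`. -/
structure TwoStep (h : ℤ) (d : (ℤ × ℤ) × (ℤ × ℤ)) (ω : Step × Step) : Prop where
  disp : ω.1.disp + ω.2.disp = d
  height : 0 ≤ h + (ω.1.disp.1.1 - ω.1.disp.2.1)
  fst_none : ω.1 = Step.none → h = 0
  snd_none : ω.2 = Step.none → h + (ω.1.disp.1.1 - ω.1.disp.2.1) = 0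

/-- An involution on pairs of steps with the same displacement which exchanges the two exponents,
shifted by one when `α` (resp. `β`) requires the `ℓC`-signs to decrease (resp. the `rC`-signs to
increase). The pairs `(opn, cls)` and `(cls, opn)` together with `(pos, neg)` and `(neg, pos)` carry
a three-dimensional and a one-dimensional weight system. -/
def swapStep : Bool → Bool → Step × Step → Step × Step
  | false, false, (.pos, b) => (b, .pos)
  | false, false, (.neg, b) => (b, .neg)
  | false, false, (a, .pos) => (.pos, a)
  | false, false, (a, .neg) => (.neg, a)
  | true, false, (.pos, .neg) => (.opn, .cls)
  | true, false, (.opn, .cls) => (.pos, .neg)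
  | false, true, (.neg, .pos) => (.opn, .cls)
  | false, true, (.opn, .cls) => (.neg, .pos)
  | _, _, ω => ω

theorem swapStep_involutive (α β : Bool) : Function.Involutive (swapStep α β) := by
  unfold Function.Involutive; revert α β; decide

theorem swapStep_pins (α β : Bool) (ω : Step × Step)
  (h : (α = true → ω.2.left < ω.1.left) ∧ (β = true → ω.1.right < ω.2.right)) :
    (α = true → (swapStep α β ω).2.left < (swapStep α β ω).1.left) ∧
      (β = true → (swapStep α β ω).1.right < (swapStep α β ω).2.right) := by
  revert α β ω; decide

theorem TwoStep.swap {h : ℤ} {d : (ℤ × ℤ) × (ℤ × ℤ)} (hd : 0 ≤ h + (d.1.1 - d.2.1)) (h0 : 0 ≤ h)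
    (α β : Bool)
    {ω : Step × Step} (hω : TwoStep h d ω)
    (hp : (α = true → ω.2.left < ω.1.left) ∧ (β = true → ω.1.right < ω.2.right)) :
    TwoStep h d (swapStep α β ω) ∧
      (swapStep α β ω).1.wt + β.toNat = ω.2.wt + α.toNat ∧
      (swapStep α β ω).2.wt + α.toNat = ω.1.wt + β.toNat := by
  obtain ⟨h1, h2, h3, h4⟩ := hω
  subst h1
  obtain ⟨a, b⟩ := ω
  cases α <;> cases β <;> cases a <;> cases b <;>
    simp [swapStep, Step.disp, Step.left, Step.right, Step.wt, Step.signVec] at * <;> 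
    first
    | done
    | (refine ⟨?_, ?_, ?_, ?_⟩ <;> simp [Step.disp, Step.left, Step.right, Step.signVec] <;> omega)
    | omega

/-! ### Commutation of the transfer operators -/

section Transfer

variable {n : ℕ} {δ δ' : Fin n → ℤ}

/-- Adjacent half-columns `rC` and `ℓC'` with total displacements `u` and `v` constrain each other at the
level between two steps: one of the slacks `c`, `c'` vanishes and both displacements move it. -/
def Linked (c c' : ℤ) (u v : ℤ × ℤ) : Prop :=
  (c = 0 ∧ u.1 = 1 ∧ v.1 = 1) ∨ (c' = 0 ∧ u.2 = 1 ∧ v.2 = 1)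

/-- At the intermediate level, the conditions between adjacent columns forbid exactly one pattern on
linked half-columns: increasing signs in `rC` next to decreasing signs in `ℓC'`. -/
theorem adjacent_iff {c c' : ℤ} (hc : 0 ≤ c) (hc' : 0 ≤ c') (a b a' b' : SignType)
    (h1 : (Step.signVec a' + Step.signVec b').1 ≤ (Step.signVec a + Step.signVec b).1 + c)
    (h2 : (Step.signVec a + Step.signVec b).2 ≤ (Step.signVec a' + Step.signVec b').2 + c') :
    ((Step.signVec a').1 ≤ (Step.signVec a).1 + c ∧
      (Step.signVec a).2 ≤ (Step.signVec a').2 + c') ↔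
    ¬ (Linked c c' (Step.signVec a + Step.signVec b) (Step.signVec a' + Step.signVec b') ∧
      a < b ∧ b' < a') := by
  have e1 : ∀ s t : SignType, s < t ↔ (s : ℤ) < t := by decide
  rw [e1, e1]
  unfold Linked
  cases a <;> cases b <;> cases a' <;> cases b' <;>
    simp [Step.signVec] at h1 h2 ⊢ <;> omega

open Classical in
/-- The weight of two consecutive steps in one column, zero if they are not possible. -/
noncomputable def twoStepWeight (h : ℤ) (d : (ℤ × ℤ) × (ℤ × ℤ)) (x y : ℂˣ) (ω : Step × Step) : ℂ :=
  if TwoStep h d ω then ((x ^ ω.1.wt * y ^ ω.2.wt : ℂˣ) : ℂ) else 0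

open Classical in
theorem sum_twoStepWeight_comm {h : ℤ} {d : (ℤ × ℤ) × (ℤ × ℤ)} (h0 : 0 ≤ h)
    (hd : 0 ≤ h + (d.1.1 - d.2.1)) (x y : ℂˣ) (α β : Bool) :
    (∑ ω : Step × Step,
      if (α = true → ω.2.left < ω.1.left) ∧ (β = true → ω.1.right < ω.2.right) then
        (if α then (y : ℂ) else 1) * (if β then (x : ℂ) else 1) * twoStepWeight h d x y ω else 0) =
    ∑ ω : Step × Step,
      if (α = true → ω.2.left < ω.1.left) ∧ (β = true → ω.1.right < ω.2.right) then
        (if α then (x : ℂ) else 1) * (if β then (y : ℂ) else 1) * twoStepWeight h d y x ω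
        else 0 := by
  refine Fintype.sum_equiv ((swapStep_involutive α β).toPerm) _ _ fun ω => ?_
  rw [Function.Involutive.coe_toPerm]
  have key : ∀ (α β : Bool) (ω : Step × Step) (x y : ℂˣ),
      (if α then (y : ℂ) else 1) * (if β then (x : ℂ) else 1) *
        ((x ^ ω.1.wt * y ^ ω.2.wt : ℂˣ) : ℂ) =
      ((x ^ (ω.1.wt + β.toNat) * y ^ (ω.2.wt + α.toNat) : ℂˣ) : ℂ) := by
    intro α β ω x y
    cases α <;> cases β <;> simp [zpow_add_one] <;> ring
  by_cases hp : (α = true → ω.2.left < ω.1.left) ∧ (β = true → ω.1.right < ω.2.right)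
  · rw [if_pos hp, if_pos (swapStep_pins α β ω hp)]
    unfold twoStepWeight
    by_cases ht : TwoStep h d ω
    · obtain ⟨t1, t2, t3⟩ := TwoStep.swap hd h0 α β ht hp
      rw [if_pos ht, if_pos t1, key, key, t2, t3, mul_comm]
    · have : ¬ TwoStep h d (swapStep α β ω) := by
        intro ht'
        have := (TwoStep.swap hd h0 α β ht' (swapStep_pins α β ω hp)).1
        rw [swapStep_involutive α β ω] at this
        exact ht this
      rw [if_neg ht, if_neg this, mul_zero, mul_zero]
  · rw [if_neg hp, if_neg]
    intro hp'
    have := swapStep_pins α β _ hp'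
    rw [swapStep_involutive α β ω] at this
    exact hp this

/-- Between fixed good states, two allowed steps are column-wise conditions together with chain
conditions on adjacent columns. -/
theorem allowed_two_iff {σ : State n} {d : State n} (hσ : Good δ δ' σ) (hτ : Good δ δ' (σ + d))
    (ω : Fin (n + 1) → Step × Step) :
    ((fun j => (ω j).1.disp + (ω j).2.disp) = d ∧ Allowed δ δ' σ (fun j => (ω j).1) ∧
      Allowed δ δ' (σ.next fun j => (ω j).1) (fun j => (ω j).2)) ↔
    (∀ j, TwoStep ((σ j).1.1 - (σ j).2.1) (d j) (ω j)) ∧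
    ∀ i : Fin n, ¬ (Linked ((σ i.castSucc).2.1 + δ i - (σ i.succ).1.1)
        ((σ i.succ).1.2 + δ' i - (σ i.castSucc).2.2) (d i.castSucc).2 (d i.succ).1 ∧
      (ω i.castSucc).1.right < (ω i.castSucc).2.right ∧
      (ω i.succ).2.left < (ω i.succ).1.left) := by
  have adj : ∀ (_ : ∀ j, (ω j).1.disp + (ω j).2.disp = d j) (i : Fin n),
      (¬ (Linked ((σ i.castSucc).2.1 + δ i - (σ i.succ).1.1)
        ((σ i.succ).1.2 + δ' i - (σ i.castSucc).2.2) (d i.castSucc).2 (d i.succ).1 ∧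
      (ω i.castSucc).1.right < (ω i.castSucc).2.right ∧
      (ω i.succ).2.left < (ω i.succ).1.left)) ↔
      ((σ.next fun j => (ω j).1) i.succ).1.1 ≤ ((σ.next fun j => (ω j).1) i.castSucc).2.1 + δ i ∧
      ((σ.next fun j => (ω j).1) i.castSucc).2.2 ≤
        ((σ.next fun j => (ω j).1) i.succ).1.2 + δ' i := by
    intro hd i
    have u := hτ.unbar i
    have b := hτ.bar i
    have u0 := hσ.unbar i
    have b0 := hσ.bar i
    simp only [Pi.add_apply, Prod.fst_add, Prod.snd_add, ← hd, Step.disp] at u b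
    have := adjacent_iff (c := (σ i.castSucc).2.1 + δ i - (σ i.succ).1.1)
      (c' := (σ i.succ).1.2 + δ' i - (σ i.castSucc).2.2) (by omega) (by omega)
      (ω i.castSucc).1.right (ω i.castSucc).2.right (ω i.succ).1.left (ω i.succ).2.left
      (by simp only [Prod.fst_add]; omega) (by simp only [Prod.snd_add]; omega)
    rw [← hd, ← hd]
    refine this.symm.trans ?_
    simp only [State.next, Prod.fst_add, Prod.snd_add, Step.disp]
    constructor <;> rintro ⟨h1, h2⟩ <;> constructor <;> omega
  constructor
  · rintro ⟨hd, ha, hb⟩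
    have hd' : ∀ j, (ω j).1.disp + (ω j).2.disp = d j := fun j => congrFun hd j
    refine ⟨fun j => ⟨hd' j, ?_, ?_, ?_⟩, fun i => (adj hd' i).2 ⟨ha.target.unbar i, ha.target.bar i⟩⟩
    · have := ha.target.height j
      simp only [State.next, Prod.fst_add, Prod.snd_add] at this
      omega
    · intro h
      have := ha.none_height j h
      omega
    · intro h
      have := hb.none_height j h
      simp only [State.next, Prod.fst_add, Prod.snd_add] at this
      omega
  · rintro ⟨ht, hl⟩
    have hd' : ∀ j, (ω j).1.disp + (ω j).2.disp = d j := fun j => (ht j).disp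
    have hmid : Good δ δ' (σ.next fun j => (ω j).1) := by
      refine ⟨fun j => ?_, fun i => ((adj hd' i).1 (hl i)).1, fun i => ((adj hd' i).1 (hl i)).2⟩
      have := (ht j).height
      simp only [State.next, Prod.fst_add, Prod.snd_add]
      omega
    have hend : (σ.next fun j => (ω j).1).next (fun j => (ω j).2) = σ + d := by
      funext j
      simp only [State.next, Pi.add_apply, ← hd', add_assoc]
    refine ⟨funext hd', ⟨hσ, hmid, fun j h => ?_⟩, ⟨hmid, hend ▸ hτ, fun j h => ?_⟩⟩
    · have := (ht j).fst_none h
      omega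
    · have := (ht j).snd_none h
      simp only [State.next, Prod.fst_add, Prod.snd_add]
      omega

open Classical in
/-- The weight of two consecutive steps in all columns, zero if they are not allowed. -/
noncomputable def pathWeight (δ δ' : Fin n → ℤ) (x y : ℂˣ) (σ : State n)
    (ω : Fin (n + 1) → Step × Step) : ℂ :=
  if Allowed δ δ' σ (fun j => (ω j).1) ∧
      Allowed δ δ' (σ.next fun j => (ω j).1) (fun j => (ω j).2) then
    ∏ j, ((x ^ (ω j).1.wt * y ^ (ω j).2.wt : ℂˣ) : ℂ) else 0

open Classical in
theorem sum_pathWeight_comm (x y : ℂˣ) (σ d : State n) :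
    (∑ ω : Fin (n + 1) → Step × Step, if (fun j => (ω j).1.disp + (ω j).2.disp) = d then
      pathWeight δ δ' x y σ ω else 0) =
    ∑ ω : Fin (n + 1) → Step × Step, if (fun j => (ω j).1.disp + (ω j).2.disp) = d then
      pathWeight δ δ' y x σ ω else 0 := by
  by_cases hg : Good δ δ' σ ∧ Good δ δ' (σ + d)
  · obtain ⟨hσ, hτ⟩ := hg
    have conv : ∀ (x y : ℂˣ) (ω : Fin (n + 1) → Step × Step),
        (if (fun j => (ω j).1.disp + (ω j).2.disp) = d then pathWeight δ δ' x y σ ω else 0) =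
        if ∀ i : Fin n, ¬ (Linked ((σ i.castSucc).2.1 + δ i - (σ i.succ).1.1)
            ((σ i.succ).1.2 + δ' i - (σ i.castSucc).2.2) (d i.castSucc).2 (d i.succ).1 ∧
          (ω i.castSucc).1.right < (ω i.castSucc).2.right ∧
          (ω i.succ).2.left < (ω i.succ).1.left) then
        ∏ j, twoStepWeight ((σ j).1.1 - (σ j).2.1) (d j) x y (ω j) else 0 := by
      intro x y ω
      have iff := allowed_two_iff hσ hτ ω
      unfold pathWeight
      rw [← ite_and]
      by_cases ht : ∀ j, TwoStep ((σ j).1.1 - (σ j).2.1) (d j) (ω j)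
      · have : (∏ j, twoStepWeight ((σ j).1.1 - (σ j).2.1) (d j) x y (ω j)) =
            ∏ j, ((x ^ (ω j).1.wt * y ^ (ω j).2.wt : ℂˣ) : ℂ) :=
          prod_congr rfl fun j _ => if_pos (ht j)
        rw [this]
        refine if_congr (iff.trans ?_) rfl rfl
        exact ⟨fun h => h.2, fun h => ⟨ht, h⟩⟩
      · rw [if_neg fun h => ht (iff.1 h).1]
        push Not at ht
        obtain ⟨j, hj⟩ := ht
        rw [prod_eq_zero (mem_univ j) (if_neg hj), ite_self]
    simp only [conv]
    have chain := sum_chain_eq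
      (fun i : Fin n => Linked ((σ i.castSucc).2.1 + δ i - (σ i.succ).1.1)
        ((σ i.succ).1.2 + δ' i - (σ i.castSucc).2.2) (d i.castSucc).2 (d i.succ).1)
      (fun ω : Step × Step => ω.2.left < ω.1.left)
      (fun ω : Step × Step => ω.1.right < ω.2.right)
      (fun j => twoStepWeight ((σ j).1.1 - (σ j).2.1) (d j) x y)
      (fun j => twoStepWeight ((σ j).1.1 - (σ j).2.1) (d j) y x) (c := (x : ℂ)) (e := (y : ℂ))
      (c' := (y : ℂ)) (e' := (x : ℂ)) (mul_comm _ _) (mul_ne_zero x.ne_zero y.ne_zero) ?_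
    · convert chain
    intro j α β
    refine Eq.trans ?_ ((sum_twoStepWeight_comm (h := (σ j).1.1 - (σ j).2.1) (d := d j)
      ?_ ?_ x y α β).trans ?_)
    · congr!
    rotate_left 2
    · congr!
    · have := hσ.height j
      omega
    · have := hτ.height j
      simp only [Pi.add_apply, Prod.fst_add, Prod.snd_add] at this
      omega
  · have zero : ∀ (x y : ℂˣ) (ω : Fin (n + 1) → Step × Step),
        (if (fun j => (ω j).1.disp + (ω j).2.disp) = d then pathWeight δ δ' x y σ ω else 0) = 0 := by
      intro x y ω
      unfold pathWeight
      rw [← ite_and]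
      refine if_neg ?_
      rintro ⟨h1, h2, h3⟩
      refine hg ⟨h2.source, ?_⟩
      have := h3.target
      rw [← h1]
      convert this using 1
      funext j
      simp only [State.next, Pi.add_apply, add_assoc]
    simp only [zero]

theorem transfer_transfer (x y : ℂˣ) (V : State n → ℂ) (σ : State n) :
    transfer δ δ' x (transfer δ δ' y V) σ =
    ∑ ω : Fin (n + 1) → Step × Step, pathWeight δ δ' x y σ ω *
      V (σ + fun j => (ω j).1.disp + (ω j).2.disp) := by
  classical
  rw [← (Equiv.arrowProdEquivProdArrow (Fin (n + 1)) (fun _ => Step) (fun _ => Step)).symm.sum_comp,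
    Fintype.sum_prod_type]
  unfold transfer
  refine sum_congr rfl fun a _ => ?_
  split_ifs with ha
  · rw [mul_sum]
    refine sum_congr rfl fun b _ => ?_
    have hend : (σ + fun j => (a j).disp + (b j).disp) = (σ.next a).next b := by
      funext j
      simp only [State.next, Pi.add_apply, add_assoc]
    simp only [pathWeight, Equiv.arrowProdEquivProdArrow, Equiv.coe_fn_symm_mk, hend, ha, true_and,
      mul_ite, ite_mul, zero_mul, mul_zero, Units.val_mul, prod_mul_distrib, mul_assoc]
  · symm
    refine sum_eq_zero fun b _ => ?_
    simp only [pathWeight, Equiv.arrowProdEquivProdArrow, Equiv.coe_fn_symm_mk, ha, false_and,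
      if_false, zero_mul]

theorem transfer_comm (x y : ℂˣ) (V : State n → ℂ) :
    transfer δ δ' x (transfer δ δ' y V) = transfer δ δ' y (transfer δ δ' x V) := by
  classical
  have group : ∀ (x y : ℂˣ) (σ : State n), transfer δ δ' x (transfer δ δ' y V) σ =
      ∑ d ∈ (univ : Finset (Fin (n + 1) → Step × Step)).image
        (fun ω j => (ω j).1.disp + (ω j).2.disp),
        (∑ ω : Fin (n + 1) → Step × Step, if (fun j => (ω j).1.disp + (ω j).2.disp) = d then
          pathWeight δ δ' x y σ ω else 0) * V (σ + d) := by
    intro x y σ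
    rw [transfer_transfer, ← sum_fiberwise_of_maps_to (g := fun (ω : Fin (n + 1) → Step × Step) j =>
      (ω j).1.disp + (ω j).2.disp) (t := univ.image _) fun ω _ => mem_image_of_mem _ (mem_univ ω)]
    refine sum_congr rfl fun d _ => ?_
    rw [← sum_filter, sum_mul]
    refine sum_congr rfl fun ω hω => ?_
    rw [(mem_filter.1 hω).2]
  funext σ
  rw [group, group]
  refine sum_congr rfl fun d _ => ?_
  rw [sum_pathWeight_comm]

/-! ### Inversion of the last variable -/

/-- The steps into a final state are given by column-wise conditions together with chain conditions on
adjacent columns: between complete columns the condition on barred letters follows from the one on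
unbarred letters. -/
theorem allowed_final_iff {k : Fin (n + 1) → ℤ} {σ : State n} (hσ : Good δ δ' σ)
    (hδ : ∀ i : Fin n, δ' i = k i.castSucc + δ i - k i.succ) (a : Fin (n + 1) → Step) :
    (Allowed δ δ' σ a ∧ Final k (σ.next a)) ↔
    (∀ j, ((σ j + (a j).disp).2 = (σ j + (a j).disp).1 ∧
      (σ j + (a j).disp).1.1 + (σ j + (a j).disp).1.2 = k j)) ∧
    ∀ i : Fin n, ¬ ((σ i.castSucc).2.1 + δ i - (σ i.succ).1.1 = 0 ∧
      (a i.castSucc).right = -1 ∧ (a i.succ).left = 1) := by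
  have expand : ∀ j, ((σ j + (a j).disp).2 = (σ j + (a j).disp).1 ∧
      (σ j + (a j).disp).1.1 + (σ j + (a j).disp).1.2 = k j) →
      (σ j).2.1 + (Step.signVec (a j).right).1 = (σ j).1.1 + (Step.signVec (a j).left).1 ∧
      (σ j).2.2 + (Step.signVec (a j).right).2 = (σ j).1.2 + (Step.signVec (a j).left).2 ∧
      (σ j).1.1 + (Step.signVec (a j).left).1 +
        ((σ j).1.2 + (Step.signVec (a j).left).2) = k j :=
    fun j h => ⟨congrArg Prod.fst h.1, congrArg Prod.snd h.1, h.2⟩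
  constructor
  · rintro ⟨ha, hf⟩
    refine ⟨fun j => ⟨hf.eq j, hf.sum j⟩, ?_⟩
    rintro i ⟨h1, h2, h3⟩
    have := ha.target.unbar i
    simp only [State.next, Step.disp, Prod.fst_add, Prod.snd_add, h2, h3] at this
    have e1 : (Step.signVec 1).1 = 1 := rfl
    have e2 : (Step.signVec (-1)).1 = 0 := rfl
    omega
  · rintro ⟨hf, hl⟩
    have adj : ∀ i : Fin n, ((σ.next a) i.succ).1.1 ≤ ((σ.next a) i.castSucc).2.1 + δ i ∧
        ((σ.next a) i.castSucc).2.2 ≤ ((σ.next a) i.succ).1.2 + δ' i := by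
      intro i
      obtain ⟨f1, f2, f3⟩ := expand _ (hf i.castSucc)
      obtain ⟨g1, g2, g3⟩ := expand _ (hf i.succ)
      have u := hσ.unbar i
      have b := hσ.bar i
      have d := hδ i
      have l := hl i
      simp only [State.next, Step.disp, Prod.fst_add, Prod.snd_add]
      generalize (a i.castSucc).right = s at *
      generalize (a i.succ).left = t at *
      cases s <;> cases t <;> simp [Step.signVec] at * <;> omega
    refine ⟨⟨hσ, ⟨fun j => ?_, fun i => (adj i).1, fun i => (adj i).2⟩, fun j h => ?_⟩,
      fun j => (hf j).1, fun j => (hf j).2⟩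
    · exact (congrArg Prod.fst (hf j).1).le
    · have := (expand _ (hf j)).1
      rw [h] at this
      simpa [Step.left, Step.right, Step.signVec] using this.symm

open Classical in
/-- The weight of the last step in one column, zero if it does not complete the column. -/
noncomputable def lastWeight (s : (ℤ × ℤ) × (ℤ × ℤ)) (k : ℤ) (x : ℂˣ) (a : Step) : ℂ :=
  if (s + a.disp).2 = (s + a.disp).1 ∧ (s + a.disp).1.1 + (s + a.disp).1.2 = k
    then ((x ^ a.wt : ℂˣ) : ℂ) else 0

/-- The involution exchanging `pos` and `neg`, unless a sign is prescribed. -/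
def negStep : Bool → Bool → Step → Step
  | false, false, .pos => .neg
  | false, false, .neg => .pos
  | _, _, a => a

open Classical in
theorem sum_lastWeight_inv {s : (ℤ × ℤ) × (ℤ × ℤ)} (hs : s.2.1 ≤ s.1.1) (k : ℤ) (x : ℂˣ)
    (α β : Bool) :
    (∑ a : Step, if (α = true → a.left = 1) ∧ (β = true → a.right = -1) then
        (if α then ((x⁻¹ : ℂˣ) : ℂ) else 1) * (if β then (x : ℂ) else 1) * lastWeight s k x a
        else 0) =
    ∑ a : Step, if (α = true → a.left = 1) ∧ (β = true → a.right = -1) then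
        (if α then (x : ℂ) else 1) * (if β then ((x⁻¹ : ℂˣ) : ℂ) else 1) * lastWeight s k x⁻¹ a
        else 0 := by
  have inv : Function.Involutive (negStep α β) := by
    unfold Function.Involutive; revert α β; decide
  refine Fintype.sum_equiv inv.toPerm _ _ fun a => ?_
  rw [Function.Involutive.coe_toPerm]
  obtain ⟨⟨p, q⟩, r, t⟩ := s
  have hx : (x : ℂ) ≠ 0 := x.ne_zero
  have h2 : ¬ r = p + 1 := fun h => by simp [h] at hs
  have h1 : ∀ c : ℤ, p + 1 + q = c ↔ p + (q + 1) = c := fun c => by rw [add_right_comm, add_assoc]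
  cases α <;> cases β <;> cases a <;>
    simp [negStep, Step.left, Step.right, lastWeight, Step.wt, Step.disp, Step.signVec, hx, h1, h2]

/-- The symmetry under the reflection in the long simple root. -/
theorem transfer_finalValue_inv {k : Fin (n + 1) → ℤ}
    (hδ : ∀ i : Fin n, δ' i = k i.castSucc + δ i - k i.succ) (x : ℂˣ) :
    transfer δ δ' x (finalValue k) = transfer δ δ' x⁻¹ (finalValue k) := by
  classical
  funext σ
  by_cases hσ : Good δ δ' σ
  · have conv : ∀ (x : ℂˣ) (a : Fin (n + 1) → Step),
        (if Allowed δ δ' σ a then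
          (∏ j, ((x ^ (a j).wt : ℂˣ) : ℂ)) * finalValue k (σ.next a) else 0) =
        if ∀ i : Fin n, ¬ ((σ i.castSucc).2.1 + δ i - (σ i.succ).1.1 = 0 ∧
          (a i.castSucc).right = -1 ∧ (a i.succ).left = 1) then
        ∏ j, lastWeight (σ j) (k j) x (a j) else 0 := by
      intro x a
      have iff := allowed_final_iff hσ hδ a
      unfold finalValue
      rw [mul_ite, mul_one, mul_zero, ← ite_and]
      by_cases ht : ∀ j, ((σ j + (a j).disp).2 = (σ j + (a j).disp).1 ∧
          (σ j + (a j).disp).1.1 + (σ j + (a j).disp).1.2 = k j)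
      · have : (∏ j, lastWeight (σ j) (k j) x (a j)) = ∏ j, ((x ^ (a j).wt : ℂˣ) : ℂ) :=
          prod_congr rfl fun j _ => if_pos (ht j)
        rw [this]
        refine if_congr (iff.trans ?_) rfl rfl
        exact ⟨fun h => h.2, fun h => ⟨ht, h⟩⟩
      · rw [if_neg fun h => ht (iff.1 h).1]
        push Not at ht
        obtain ⟨j, hj⟩ := ht
        rw [prod_eq_zero (mem_univ j) (if_neg fun h => hj h.1 h.2), ite_self]
    unfold transfer
    have chain := sum_chain_eq
      (fun i : Fin n => (σ i.castSucc).2.1 + δ i - (σ i.succ).1.1 = 0)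
      (fun a : Step => a.left = 1) (fun a : Step => a.right = -1)
      (fun j => lastWeight (σ j) (k j) x) (fun j => lastWeight (σ j) (k j) x⁻¹)
      (c := (x : ℂ)) (e := ((x⁻¹ : ℂˣ) : ℂ)) (c' := ((x⁻¹ : ℂˣ) : ℂ)) (e' := (x : ℂ))
      (mul_comm _ _) (mul_ne_zero x.ne_zero x⁻¹.ne_zero) ?_
    · simp only [conv]
      convert chain
    intro j α β
    convert sum_lastWeight_inv (hσ.height j) (k j) x α β
  · unfold transfer
    refine sum_congr rfl fun a _ => ?_
    rw [if_neg fun h => hσ h.source, if_neg fun h => hσ h.source]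

/-! ### Words as paths of states -/

/-- The state reached from `σ` after the steps of the word `w` with index below `v`. -/
def State.after {n m : ℕ} (σ : State n) (w : Fin m → Fin (n + 1) → Step) (v : ℕ) : State n :=
  fun j => σ j + ∑ u : Fin m, if (u : ℕ) < v then (w u j).disp else 0

/-- The word `w` leads from `σ` to a final state through allowed steps. -/
structure ValidFrom {m : ℕ} (δ δ' : Fin n → ℤ) (k : Fin (n + 1) → ℤ) (σ : State n)
    (w : Fin m → Fin (n + 1) → Step) : Prop where
  allowed : ∀ v : Fin m, Allowed δ δ' (σ.after w v) (w v)
  final : Final k (σ.after w m)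

theorem State.after_zero {m : ℕ} (σ : State n) (w : Fin m → Fin (n + 1) → Step) :
    σ.after w 0 = σ := by
  funext j; simp [State.after]

theorem State.after_succ {m : ℕ} (σ : State n) (w : Fin (m + 1) → Fin (n + 1) → Step) (v : ℕ) :
    σ.after w (v + 1) = (σ.next (w 0)).after (Fin.tail w) v := by
  funext j
  simp [State.after, State.next, Fin.sum_univ_succ, Fin.tail, add_assoc]

theorem validFrom_succ {m : ℕ} {k : Fin (n + 1) → ℤ} {σ : State n}
    {w : Fin (m + 1) → Fin (n + 1) → Step} :
    ValidFrom δ δ' k σ w ↔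
      Allowed δ δ' σ (w 0) ∧ ValidFrom δ δ' k (σ.next (w 0)) (Fin.tail w) := by
  constructor
  · rintro ⟨h1, h2⟩
    refine ⟨?_, fun v => ?_, ?_⟩
    · have := h1 0
      rwa [Fin.val_zero, State.after_zero] at this
    · have := h1 v.succ
      rwa [Fin.val_succ, State.after_succ] at this
    · rwa [State.after_succ] at h2
  · rintro ⟨h0, h1, h2⟩
    refine ⟨fun v => ?_, ?_⟩
    · induction v using Fin.cases with
      | zero => rwa [Fin.val_zero, State.after_zero]
      | succ v => rw [Fin.val_succ, State.after_succ]; exact h1 v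
    · rwa [State.after_succ]

open Classical in
theorem foldr_transfer_eq_sum {m : ℕ} (k : Fin (n + 1) → ℤ) (x : Fin m → ℂˣ) (σ : State n) :
    (List.ofFn x).foldr (transfer δ δ') (finalValue k) σ =
      ∑ w : Fin m → Fin (n + 1) → Step, if ValidFrom δ δ' k σ w then
        ∏ v, ∏ j, ((x v ^ (w v j).wt : ℂˣ) : ℂ) else 0 := by
  induction m generalizing σ with
  | zero =>
    have : ValidFrom δ δ' k σ (default : Fin 0 → Fin (n + 1) → Step) ↔ Final k σ :=
      ⟨fun h => by simpa [State.after_zero] using h.final,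
        fun h => ⟨fun v => v.elim0, by simpa [State.after_zero] using h⟩⟩
    rw [Fintype.sum_unique]
    simp only [this, univ_eq_empty, prod_empty]
    rfl
  | succ m ih =>
    rw [List.ofFn_succ, List.foldr_cons, ← (Fin.consEquiv fun _ => Fin (n + 1) → Step).sum_comp,
      Fintype.sum_prod_type]
    unfold transfer
    refine sum_congr rfl fun a _ => ?_
    simp only [Fin.consEquiv_apply, validFrom_succ, Fin.cons_zero]
    split_ifs with ha
    · have := ih (fun v => x v.succ) (σ.next a)
      unfold transfer at this
      rw [this, mul_sum]
      refine sum_congr rfl fun w _ => ?_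
      have tail : Fin.tail (Fin.consEquiv (fun _ => Fin (n + 1) → Step) (a, w)) = w := rfl
      rw [tail]
      simp [ha, Fin.prod_univ_succ]
    · simp [ha]

/-- The generating function of all valid words, as an iterated transfer operator. -/
noncomputable def wordSum (δ δ' : Fin n → ℤ) (k : Fin (n + 1) → ℤ) {m : ℕ} (x : Fin m → ℂˣ) : ℂ :=
  (List.ofFn x).foldr (transfer δ δ') (finalValue k) 0

theorem wordSum_perm (k : Fin (n + 1) → ℤ) {m : ℕ} (x : Fin m → ℂˣ) (π : Equiv.Perm (Fin m)) :
    wordSum δ δ' k (x ∘ π) = wordSum δ δ' k x := by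
  unfold wordSum
  have : LeftCommutative (transfer δ δ') := ⟨fun x y V => transfer_comm x y V⟩
  rw [(π.ofFn_comp_perm x).foldr_eq]

theorem wordSum_update_inv {k : Fin (n + 1) → ℤ}
    (hδ : ∀ i : Fin n, δ' i = k i.castSucc + δ i - k i.succ) {m : ℕ} (x : Fin m → ℂˣ) (i : Fin m) :
    wordSum δ δ' k (Function.update x i (x i)⁻¹) = wordSum δ δ' k x := by
  obtain ⟨m, rfl⟩ : ∃ m', m = m' + 1 := ⟨m - 1, by have := i.isLt; omega⟩
  have last : ∀ x : Fin (m + 1) → ℂˣ,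
      wordSum δ δ' k (Function.update x (Fin.last m) (x (Fin.last m))⁻¹) = wordSum δ δ' k x := by
    intro x
    unfold wordSum
    rw [List.ofFn_succ', List.ofFn_succ', List.concat_eq_append, List.concat_eq_append,
      List.foldr_append, List.foldr_append]
    simp only [Function.update_self, List.foldr_cons, List.foldr_nil]
    rw [← transfer_finalValue_inv hδ]
    simp
  rw [← wordSum_perm k _ (Equiv.swap i (Fin.last m)), ← wordSum_perm k x (Equiv.swap i (Fin.last m)),
    ← last]
  congr 1
  funext v
  by_cases hv : v = Fin.last m
  · subst hv; simp
  · rw [Function.update_of_ne hv]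
    simp only [Function.comp_apply]
    rw [Function.update_of_ne]
    intro h
    rw [Equiv.swap_apply_eq_iff, Equiv.swap_apply_left] at h
    exact hv h

end Transfer

variable {m n : ℕ}

/-! ### Splittings and balanced words -/

theorem unbarred_injective : Function.Injective (unbarred : Fin m → Letter m) := by
  intro a b h
  simpa [unbarred, Fin.ext_iff] using h

theorem barred_injective : Function.Injective (barred : Fin m → Letter m) := by
  intro a b h
  simp only [barred, Fin.ext_iff] at h
  ext
  have := a.isLt
  have := b.isLt
  omega

theorem unbarred_ne_barred (a b : Fin m) : unbarred a ≠ barred b := by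
  intro h
  simp only [unbarred, barred, Fin.ext_iff] at h
  have := a.isLt
  have := b.isLt
  omega

theorem eq_unbarred_or_barred (a : Letter m) : (∃ v, a = unbarred v) ∨ ∃ v, a = barred v := by
  have ha := a.isLt
  by_cases h : (a : ℕ) < m
  · exact Or.inl ⟨⟨a, h⟩, rfl⟩
  · refine Or.inr ⟨⟨2 * m - 1 - a, by omega⟩, ?_⟩
    simp only [barred, Fin.ext_iff]
    omega

theorem letter_ext {A B : Finset (Letter m)} (h1 : ∀ v, unbarred v ∈ A ↔ unbarred v ∈ B)
    (h2 : ∀ v, barred v ∈ A ↔ barred v ∈ B) : A = B := by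
  ext a
  obtain ⟨v, rfl⟩ | ⟨v, rfl⟩ := eq_unbarred_or_barred a
  · exact h1 v
  · exact h2 v

/-- The set of letters with given sets of unbarred and of barred indices. -/
def letters (P Q : Finset (Fin m)) : Finset (Letter m) := P.image unbarred ∪ Q.image barred

@[simp] theorem unbarred_mem_letters {P Q : Finset (Fin m)} {v : Fin m} :
    unbarred v ∈ letters P Q ↔ v ∈ P := by
  simp only [letters, mem_union, mem_image, unbarred_injective.eq_iff, exists_eq_right]
  constructor
  · rintro (h | ⟨u, _, h⟩)
    · exact h
    · exact absurd h.symm (unbarred_ne_barred v u)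
  · exact Or.inl

@[simp] theorem barred_mem_letters {P Q : Finset (Fin m)} {v : Fin m} :
    barred v ∈ letters P Q ↔ v ∈ Q := by
  simp only [letters, mem_union, mem_image, barred_injective.eq_iff, exists_eq_right]
  constructor
  · rintro (⟨u, _, h⟩ | h)
    · exact absurd h (unbarred_ne_barred u v)
    · exact h
  · exact Or.inr

/-- The column `C` with the steps `s`. -/
def wordCol (s : Fin m → Step) : Finset (Letter m) :=
  letters {v | s v = .pos ∨ s v = .cls} {v | s v = .neg ∨ s v = .cls}

/-- The column with the signs `s`: it contains `v` if `s v = 1` and `v̄` if `s v = -1`. -/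
def signCol (s : Fin m → SignType) : Finset (Letter m) :=
  letters {v | s v = 1} {v | s v = -1}

/-- The contribution of a step to `height`. -/
def Step.rise : Step → ℤ
  | pos => 0
  | neg => 0
  | none => 0
  | opn => 1
  | cls => -1

/-- The number of `opn` minus the number of `cls` before level `v`. -/
def height (s : Fin m → Step) (v : ℕ) : ℤ := ∑ u : Fin m, if (u : ℕ) < v then (s u).rise else 0

/-- The steps form a balanced bracket sequence (`opn` opens, `cls` closes) in which `none` occurs only
outside all brackets. -/
structure Balanced (s : Fin m → Step) : Prop where
  nonneg : ∀ v : Fin m, 0 ≤ height s (v + 1)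
  none_zero : ∀ v : Fin m, s v = .none → height s v = 0
  total : height s m = 0

theorem height_eq_card_sub_card (s : Fin m → Step) (v : ℕ) :
    height s v = #{u : Fin m | s u = .opn ∧ (u : ℕ) < v} - #{u : Fin m | s u = .cls ∧ (u : ℕ) < v} := by
  rw [card_filter, card_filter]
  push_cast
  rw [← sum_sub_distrib]
  refine sum_congr rfl fun u _ => ?_
  cases s u <;> by_cases h : (u : ℕ) < v <;> simp [h, Step.rise]

theorem pairs_wordCol (s : Fin m → Step) : pairs (wordCol s) = univ.filter fun v => s v = .cls := by
  ext v
  simp only [pairs, wordCol, unbarred_mem_letters, barred_mem_letters, mem_filter, mem_univ,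
    true_and]
  cases h : s v <;> simp

theorem Balanced.admissible {s : Fin m → Step} (hs : Balanced s) : Admissible (wordCol s) := by
  intro i _ _
  have h1 : ((wordCol s).filter fun x => x ≤ unbarred i).card =
      #{v : Fin m | (s v = .pos ∨ s v = .cls) ∧ v ≤ i} := by
    refine (congrArg card ?_).trans (card_image_of_injective _ unbarred_injective)
    apply letter_ext
    · intro v
      simp [wordCol, unbarred_injective.eq_iff]
      intro _
      simp [unbarred]
    · intro v
      simp only [mem_filter, mem_image, unbarred_ne_barred, and_false, exists_false, iff_false,
        not_and, not_le]
      intro _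
      simp only [barred, unbarred, Fin.lt_def]
      have := i.isLt
      have := v.isLt
      omega
  have h2 : ((wordCol s).filter fun x => barred i ≤ x).card =
      #{v : Fin m | (s v = .neg ∨ s v = .cls) ∧ v ≤ i} := by
    refine (congrArg card ?_).trans (card_image_of_injective _ barred_injective)
    apply letter_ext
    · intro v
      simp only [mem_filter, mem_image, (unbarred_ne_barred _ _).symm, and_false, exists_false,
        iff_false, not_and, not_le]
      intro _
      simp only [barred, unbarred, Fin.lt_def]
      have := i.isLt
      have := v.isLt
      omega
    · intro v
      simp [wordCol, barred_injective.eq_iff]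
      intro _
      simp only [barred, Fin.le_def]
      have := i.isLt
      have := v.isLt
      omega
  have h3 : #{v : Fin m | s v = .cls ∧ v ≤ i} ≤ #{v : Fin m | s v = .opn ∧ v ≤ i} := by
    have := hs.nonneg i
    rw [height_eq_card_sub_card] at this
    simp only [Nat.lt_succ_iff, Fin.val_fin_le] at this
    omega
  have h4 : #{v : Fin m | v ≤ i} = i + 1 := by
    have : ({v : Fin m | v ≤ i} : Finset (Fin m)) = Iic i := by ext; simp
    rw [this, Fin.card_Iic]
  have h5 : #{v : Fin m | (s v = .pos ∨ s v = .cls) ∧ v ≤ i} +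
      #{v : Fin m | (s v = .neg ∨ s v = .cls) ∧ v ≤ i} + #{v : Fin m | s v = .opn ∧ v ≤ i} ≤
      #{v : Fin m | v ≤ i} + #{v : Fin m | s v = .cls ∧ v ≤ i} := by
    simp only [card_filter, ← sum_add_distrib]
    refine sum_le_sum fun v _ => ?_
    cases s v <;> by_cases h : v ≤ i <;> simp [h]
  rw [h1, h2]
  omega

/-- The letter `t_k` of the splitting is matched with `z_k` by the increasing bijection from the `cls`
onto the `opn` positions. It is the greatest possible choice because a `none` between `t_k` and
`z_k` would lie at positive height. -/
theorem Balanced.isSplit {s : Fin m → Step} (hs : Balanced s) :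
    IsSplit (wordCol s) (signCol fun v => (s v).left) (signCol fun v => (s v).right) := by
  set Z : Finset (Fin m) := {v | s v = .cls} with hZ
  set T : Finset (Fin m) := {v | s v = .opn} with hT
  have hcard : Z.card = T.card := by
    have := hs.total
    rw [height_eq_card_sub_card] at this
    simp only [Fin.is_lt, and_true] at this
    rw [hZ, hT]
    omega
  let f : Z ≃o T := (Z.orderIsoOfFin hcard).symm.trans (T.orderIsoOfFin rfl)
  have rank : ∀ z : Z, #{u : Fin m | s u = .opn ∧ (u : ℕ) < (f z : Fin m)} =
      #{u : Fin m | s u = .cls ∧ (u : ℕ) < (z : Fin m)} := by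
    intro z
    symm
    refine card_bij (fun u hu => (f ⟨u, by simp [hZ, (mem_filter.1 hu).2.1]⟩ : Fin m)) ?_ ?_ ?_
    · intro u hu
      have h1 := (mem_filter.1 hu).2
      have h2 := (f ⟨u, by simp [hZ, h1.1]⟩).2
      simp only [hT, mem_filter, mem_univ, true_and] at h2
      refine mem_filter.2 ⟨mem_univ _, h2, ?_⟩
      rw [Fin.val_fin_lt, Subtype.coe_lt_coe, f.lt_iff_lt]
      exact h1.2
    · intro u hu u' hu' h
      simpa using h
    · intro v hv
      have h1 := (mem_filter.1 hv).2
      have hvT : v ∈ T := by simp [hT, h1.1]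
      have h2 := (f.symm ⟨v, hvT⟩).2
      simp only [hZ, mem_filter, mem_univ, true_and] at h2
      refine ⟨f.symm ⟨v, hvT⟩, mem_filter.2 ⟨mem_univ _, h2, ?_⟩, ?_⟩
      · rw [Fin.val_fin_lt, Subtype.coe_lt_coe, f.symm_apply_lt]
        exact h1.2
      · simp
  have hlt : ∀ z : Z, (f z : Fin m) < z := by
    intro z
    by_contra hle
    push Not at hle
    have hz : s z = .cls := (mem_filter.1 z.2).2
    have h1 := hs.nonneg z
    have h2 : height s ((z : Fin m) + 1) = height s (z : Fin m) - 1 := by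
      unfold height
      have : ∀ u : Fin m, (if (u : ℕ) < (z : Fin m) + 1 then (s u).rise else 0) =
          (if (u : ℕ) < (z : Fin m) then (s u).rise else 0) + if u = z then (s u).rise else 0 := by
        intro u
        by_cases h : u = z
        · simp [h]
        · have : (u : ℕ) < (z : Fin m) + 1 ↔ (u : ℕ) < (z : Fin m) := by omega
          simp [h, this]
      simp only [this, sum_add_distrib]
      rw [sum_ite_eq' univ, if_pos (mem_univ _), hz]
      rfl
    rw [h2, height_eq_card_sub_card, ← rank z] at h1
    have : #{u : Fin m | s u = .opn ∧ (u : ℕ) < (z : Fin m)} ≤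
        #{u : Fin m | s u = .opn ∧ (u : ℕ) < (f z : Fin m)} := by
      refine card_le_card fun u hu => ?_
      simp only [mem_filter, mem_univ, true_and] at hu ⊢
      exact ⟨hu.1, by omega⟩
    omega
  have memT : ∀ v : Fin m, s v = .opn ↔ ∃ z : Z, (f z : Fin m) = v := by
    intro v
    constructor
    · intro h
      exact ⟨f.symm ⟨v, by simp [hT, h]⟩, by simp⟩
    · rintro ⟨z, rfl⟩
      exact (mem_filter.1 (f z).2).2
  let t : Fin m → Fin m := fun v => if h : v ∈ Z then f ⟨v, h⟩ else v
  have ht : ∀ z : Z, t z = f z := fun z => by simp [t]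
  refine ⟨t, ?_, ?_, ?_⟩ <;> rw [pairs_wordCol, ← hZ]
  · intro z hz
    have htz : t z = f ⟨z, hz⟩ := ht ⟨z, hz⟩
    refine ⟨⟨?_, ?_, ?_⟩, ?_⟩
    · rw [htz]; exact hlt ⟨z, hz⟩
    · intro y hy hzy
      rw [htz, show t y = f ⟨y, hy⟩ from ht ⟨y, hy⟩]
      exact f.lt_iff_lt.2 hzy
    · have := (memT (t z)).2 ⟨⟨z, hz⟩, htz.symm⟩
      simp [wordCol, this]
    · rintro v ⟨hvz, hv, hv1, hv2⟩
      by_contra hlt'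
      push Not at hlt'
      simp only [wordCol, unbarred_mem_letters, barred_mem_letters, mem_filter, mem_univ, true_and]
        at hv1 hv2
      cases hsv : s v with
      | pos => simp [hsv] at hv1
      | neg => simp [hsv] at hv2
      | cls => simp [hsv] at hv1
      | opn =>
        obtain ⟨y, rfl⟩ := (memT v).1 hsv
        rw [htz] at hlt'
        have := hv y y.2 (f.lt_iff_lt.1 hlt')
        rw [ht y] at this
        exact lt_irrefl _ this
      | none =>
        have h0 := hs.none_zero v hsv
        rw [height_eq_card_sub_card] at h0
        have r := rank ⟨z, hz⟩
        have h1 : #{u : Fin m | s u = .cls ∧ (u : ℕ) < v} ≤ #{u : Fin m | s u = .cls ∧ (u : ℕ) < z} := by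
          refine card_le_card fun u hu => ?_
          simp only [mem_filter, mem_univ, true_and] at hu ⊢
          exact ⟨hu.1, by omega⟩
        have h2 : #{u : Fin m | s u = .opn ∧ (u : ℕ) < (f ⟨z, hz⟩ : Fin m)} <
            #{u : Fin m | s u = .opn ∧ (u : ℕ) < v} := by
          refine card_lt_card (Finset.ssubset_iff_subset_ne.2 ⟨fun u hu => ?_, fun h => ?_⟩)
          · simp only [mem_filter, mem_univ, true_and] at hu ⊢
            exact ⟨hu.1, by omega⟩
          · have : (f ⟨z, hz⟩ : Fin m) ∈ ({u : Fin m | s u = .opn ∧ (u : ℕ) < v} : Finset _) := by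
              simp only [mem_filter, mem_univ, true_and]
              exact ⟨(memT _).2 ⟨_, rfl⟩, by omega⟩
            rw [← h] at this
            simp at this
        dsimp only at r
        omega
  · apply letter_ext
    · intro v
      have : (∃ z ∈ Z, unbarred (t z) = unbarred v) ↔ s v = .opn := by
        rw [memT]
        simp only [unbarred_injective.eq_iff]
        exact ⟨fun ⟨z, hz, h⟩ => ⟨⟨z, hz⟩, by rw [← ht, h]⟩, fun ⟨z, h⟩ => ⟨z, z.2, by rw [ht, h]⟩⟩
      rw [mem_union, mem_image, this]
      simp only [mem_sdiff, mem_image, signCol, wordCol, unbarred_mem_letters,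
        unbarred_injective.eq_iff, exists_eq_right, hZ, mem_filter, mem_univ, true_and]
      cases s v <;> simp [Step.left]
    · intro v
      simp only [mem_union, mem_sdiff, mem_image, signCol, wordCol, barred_mem_letters,
        unbarred_ne_barred, and_false, exists_false, mem_filter, mem_univ, true_and]
      cases s v <;> simp [Step.left]
  · apply letter_ext
    · intro v
      simp only [mem_union, mem_sdiff, mem_image, signCol, wordCol, unbarred_mem_letters,
        (unbarred_ne_barred _ _).symm, and_false, exists_false, mem_filter, mem_univ, true_and]
      cases s v <;> simp [Step.right]
    · intro v
      have : (∃ z ∈ Z, barred (t z) = barred v) ↔ s v = .opn := by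
        rw [memT]
        simp only [barred_injective.eq_iff]
        exact ⟨fun ⟨z, hz, h⟩ => ⟨⟨z, hz⟩, by rw [← ht, h]⟩, fun ⟨z, h⟩ => ⟨z, z.2, by rw [ht, h]⟩⟩
      rw [mem_union, mem_image, this]
      simp only [mem_sdiff, mem_image, signCol, wordCol, barred_mem_letters,
        barred_injective.eq_iff, exists_eq_right, hZ, mem_filter, mem_univ, true_and]
      cases s v <;> simp [Step.right]

/-- Conversely, every splitting is described by a balanced word. -/
theorem IsSplit.exists_balanced {C D E : Finset (Letter m)} (h : IsSplit C D E) :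
    ∃ s : Fin m → Step, Balanced s ∧ C = wordCol s ∧ D = signCol (fun v => (s v).left) ∧
      E = signCol (fun v => (s v).right) := by
  classical
  obtain ⟨t, ht, hD, hE⟩ := h
  have mem_pairs : ∀ v, v ∈ pairs C ↔ unbarred v ∈ C ∧ barred v ∈ C := fun v => by simp [pairs]
  have mono : ∀ y ∈ pairs C, ∀ z ∈ pairs C, z < y → t z < t y :=
    fun y hy z hz hzy => (ht z hz).1.2.1 y hy hzy
  have inj : ∀ y ∈ pairs C, ∀ z ∈ pairs C, t y = t z → y = z := by
    intro y hy z hz hyz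
    rcases lt_trichotomy y z with h | h | h
    · exact absurd hyz (mono z hz y hy h).ne
    · exact h
    · exact absurd hyz (mono y hy z hz h).ne'
  let s : Fin m → Step := fun v =>
    if unbarred v ∈ C then (if barred v ∈ C then .cls else .pos)
    else if barred v ∈ C then .neg else if v ∈ (pairs C).image t then .opn else .none
  have hcls : ∀ v, s v = .cls ↔ v ∈ pairs C := by
    intro v
    rw [mem_pairs]
    by_cases h1 : unbarred v ∈ C <;> by_cases h2 : barred v ∈ C <;>
      by_cases h3 : v ∈ (pairs C).image t <;>
      simp only [s, h1, h2, h3, if_true, if_false] <;> simp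
  have hopn : ∀ v, s v = .opn ↔ v ∈ (pairs C).image t := by
    intro v
    constructor
    · intro hv
      simp only [s] at hv
      split_ifs at hv with h1 h2 h3 h4
      exact h4
    · intro hv
      obtain ⟨z, hz, rfl⟩ := mem_image.1 hv
      have := (ht z hz).1.2.2
      simp only [s]
      rw [if_neg this.1, if_neg this.2, if_pos hv]
  have hpos : ∀ v, s v = .pos ↔ unbarred v ∈ C ∧ barred v ∉ C := by
    intro v
    by_cases h1 : unbarred v ∈ C <;> by_cases h2 : barred v ∈ C <;>
      by_cases h3 : v ∈ (pairs C).image t <;>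
      simp only [s, h1, h2, h3, if_true, if_false] <;> simp
  have hneg : ∀ v, s v = .neg ↔ unbarred v ∉ C ∧ barred v ∈ C := by
    intro v
    by_cases h1 : unbarred v ∈ C <;> by_cases h2 : barred v ∈ C <;>
      by_cases h3 : v ∈ (pairs C).image t <;>
      simp only [s, h1, h2, h3, if_true, if_false] <;> simp
  have hnone : ∀ v, s v = .none → unbarred v ∉ C ∧ barred v ∉ C ∧ v ∉ (pairs C).image t := by
    intro v hv
    simp only [s] at hv
    split_ifs at hv with h1 h2 h3 h4
    exact ⟨h1, h3, h4⟩
  have opn_card : ∀ v : ℕ, #{u : Fin m | s u = .opn ∧ (u : ℕ) < v} =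
      #{z ∈ pairs C | (t z : ℕ) < v} := by
    intro v
    symm
    refine card_bij (fun z _ => t z) ?_ ?_ ?_
    · intro z hz
      rw [mem_filter] at hz
      exact mem_filter.2 ⟨mem_univ _, (hopn _).2 (mem_image_of_mem _ hz.1), hz.2⟩
    · intro z hz y hy
      exact inj z (mem_filter.1 hz).1 y (mem_filter.1 hy).1
    · intro u hu
      obtain ⟨hu1, hu2⟩ := (mem_filter.1 hu).2
      obtain ⟨z, hz, rfl⟩ := mem_image.1 ((hopn u).1 hu1)
      exact ⟨z, mem_filter.2 ⟨hz, hu2⟩, rfl⟩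
  have cls_card : ∀ v : ℕ, #{u : Fin m | s u = .cls ∧ (u : ℕ) < v} =
      #((pairs C).filter fun z : Fin m => (z : ℕ) < v) := by
    intro v
    congr 1
    ext u
    simp [hcls]
  have hle : ∀ v : ℕ, #((pairs C).filter fun z : Fin m => (z : ℕ) < v) ≤ #{z ∈ pairs C | (t z : ℕ) < v} := by
    intro v
    refine card_le_card fun z hz => ?_
    rw [mem_filter] at hz ⊢
    have := (ht z hz.1).1.1
    exact ⟨hz.1, by omega⟩
  refine ⟨s, ⟨?_, ?_, ?_⟩, ?_, ?_, ?_⟩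
  · intro v
    rw [height_eq_card_sub_card, opn_card, cls_card]
    have := hle (v + 1)
    omega
  · intro v hv
    obtain ⟨h1, h2, h3⟩ := hnone v hv
    rw [height_eq_card_sub_card, opn_card, cls_card]
    have : {z ∈ pairs C | (t z : ℕ) < v} ⊆ (pairs C).filter fun z : Fin m => (z : ℕ) < v := by
      intro z hz
      rw [mem_filter] at hz ⊢
      refine ⟨hz.1, ?_⟩
      by_contra hzv
      -- the largest pair whose partner is below `v` would have skipped the free letter `v`
      obtain ⟨z', hz', hmax⟩ := exists_max_image
        {y ∈ pairs C | (t y : ℕ) < v ∧ ¬ (y : ℕ) < v} (fun y => y)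
        ⟨z, mem_filter.2 ⟨hz.1, hz.2, hzv⟩⟩
      obtain ⟨p, q, r⟩ := mem_filter.1 hz'
      have hne : v ≠ z' := by
        rintro rfl
        exact h1 ((mem_pairs _).1 p).1
      have : v ≤ t z' := by
        refine (ht z' p).2 ⟨by omega, ?_, h1, h2⟩
        intro y hy hzy
        by_contra hyv
        have hty : t y ≠ v := by
          rintro rfl
          exact h3 (mem_image_of_mem _ hy)
        have := hmax y (mem_filter.2 ⟨hy, by omega, by omega⟩)
        omega
      omega
    have := card_le_card this
    have := hle v
    omega
  · rw [height_eq_card_sub_card, opn_card, cls_card]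
    simp
  · apply letter_ext <;> intro v
    · simp only [wordCol, unbarred_mem_letters, mem_filter, mem_univ, true_and, hpos, hcls,
        mem_pairs]
      tauto
    · simp only [wordCol, barred_mem_letters, mem_filter, mem_univ, true_and, hneg, hcls,
        mem_pairs]
      tauto
  · have hl : ∀ v, (s v).left = 1 ↔ s v = .pos ∨ s v = .opn := by
      intro v; cases s v <;> simp [Step.left]
    have hr : ∀ v, (s v).left = -1 ↔ s v = .neg ∨ s v = .cls := by
      intro v; cases s v <;> simp [Step.left]
    rw [hD]
    apply letter_ext <;> intro v
    · simp only [signCol, mem_union, mem_sdiff, unbarred_mem_letters, mem_filter, mem_univ,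
        true_and, hl, hpos, hopn, mem_image, unbarred_injective.eq_iff, exists_eq_right, mem_pairs]
      tauto
    · simp only [signCol, mem_union, mem_sdiff, barred_mem_letters, mem_filter, mem_univ,
        true_and, hr, hneg, hcls, mem_image, unbarred_ne_barred, and_false, exists_false, mem_pairs]
      tauto
  · have hl : ∀ v, (s v).right = 1 ↔ s v = .pos ∨ s v = .cls := by
      intro v; cases s v <;> simp [Step.right]
    have hr : ∀ v, (s v).right = -1 ↔ s v = .neg ∨ s v = .opn := by
      intro v; cases s v <;> simp [Step.right]
    rw [hE]
    apply letter_ext <;> intro v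
    · simp only [signCol, mem_union, mem_sdiff, unbarred_mem_letters, mem_filter, mem_univ,
        true_and, hl, hpos, hcls, mem_image, (unbarred_ne_barred _ _).symm, and_false,
        exists_false, mem_pairs]
      tauto
    · simp only [signCol, mem_union, mem_sdiff, barred_mem_letters, mem_filter, mem_univ,
        true_and, hr, hneg, hopn, mem_image, barred_injective.eq_iff, exists_eq_right, mem_pairs]
      tauto

/-- The column `C` determines its balanced word: reading downwards from the top index, a letter absent
from `C` is an `opn` exactly when a bracket is waiting for its partner. -/
theorem Balanced.ext_of_wordCol {s s' : Fin m → Step} (hs : Balanced s) (hs' : Balanced s')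
    (h : wordCol s = wordCol s') : s = s' := by
  have split : ∀ (s : Fin m → Step) (v : Fin m), height s m =
      height s v + (s v).rise + ∑ u : Fin m, if v < u then (s u).rise else 0 := by
    intro s v
    have : (s v).rise = ∑ u : Fin m, if u = v then (s u).rise else 0 := by simp
    rw [this]
    unfold height
    rw [← sum_add_distrib, ← sum_add_distrib]
    refine sum_congr rfl fun u _ => ?_
    rw [if_pos u.isLt]
    rcases lt_trichotomy u v with h | h | h
    · have h2 : ¬ v < u := by omega
      have h3 : (u : ℕ) < v := h
      simp [h2, h3, h.ne]
    · simp [h]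
    · have h3 : ¬ (u : ℕ) < v := by omega
      simp [h, h3, h.ne']
  have nonneg : ∀ {s : Fin m → Step} (_ : Balanced s) (v : Fin m), 0 ≤ height s v := by
    intro s hs v
    obtain ⟨v, hv⟩ := v
    cases v with
    | zero => simp [height]
    | succ v => exact hs.nonneg ⟨v, by omega⟩
  have above : ∀ k : ℕ, ∀ v : Fin m, m ≤ v + k → s v = s' v := by
    intro k
    induction k with
    | zero => intro v hv; omega
    | succ k ih =>
      intro v hv
      have tail : (∑ u : Fin m, if v < u then (s u).rise else 0) =
          ∑ u : Fin m, if v < u then (s' u).rise else 0 := by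
        refine sum_congr rfl fun u _ => ?_
        split_ifs with hu
        · rw [ih u (by omega)]
        · rfl
      have hu : unbarred v ∈ wordCol s ↔ unbarred v ∈ wordCol s' := by rw [h]
      have hb : barred v ∈ wordCol s ↔ barred v ∈ wordCol s' := by rw [h]
      have e := split s v
      have e' := split s' v
      rw [hs.total] at e
      rw [hs'.total, ← tail] at e'
      generalize (∑ u : Fin m, if v < u then (s u).rise else 0) = S at e e'
      have z := hs.none_zero v
      have z' := hs'.none_zero v
      have p := nonneg hs v
      have p' := nonneg hs' v
      simp only [wordCol, unbarred_mem_letters, barred_mem_letters, mem_filter, mem_univ, true_and]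
        at hu hb
      cases h1 : s v <;> cases h2 : s' v <;>
        simp [h1, h2, Step.rise] at hu hb e e' z z' ⊢ <;> omega
  exact funext fun v => above m v (by omega)

variable {lam mu : YoungDiagram}

/-! ### Column-strict fillings -/

theorem mem_skewCells {i j : ℕ} : (i, j) ∈ skewCells lam mu ↔ mu.colLen j ≤ i ∧ i < lam.colLen j := by
  rw [skewCells, mem_sdiff, YoungDiagram.mem_cells, YoungDiagram.mem_cells,
    YoungDiagram.mem_iff_lt_colLen, YoungDiagram.mem_iff_lt_colLen, not_lt, and_comm]

theorem cell_bounds (c : ↥(skewCells lam mu)) :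
    mu.colLen c.1.2 ≤ c.1.1 ∧ c.1.1 < lam.colLen c.1.2 := mem_skewCells.1 c.2

theorem column_eq_image (T : Filling lam mu m) (j : ℕ) :
    column T j = (univ.filter fun c : ↥(skewCells lam mu) => c.1.2 = j).image T := by
  ext a
  simp [column]

theorem ColStrict.injOn {T : Filling lam mu m} (hT : ColStrict T) (j : ℕ) :
    Set.InjOn T {c | c.1.2 = j} := by
  intro c hc d hd h
  simp only [Set.mem_ofPred_eq] at hc hd
  have hcd : c.1.2 = d.1.2 := hc.trans hd.symm
  rcases lt_trichotomy c.1.1 d.1.1 with h1 | h1 | h1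
  · exact absurd h (hT c d hcd h1).ne
  · exact Subtype.ext (Prod.ext h1 hcd)
  · exact absurd h (hT d c hcd.symm h1).ne'

theorem ColStrict.card_filter_column {T : Filling lam mu m} (hT : ColStrict T) (j : ℕ)
    (p : Letter m → Prop) [DecidablePred p] :
    #((column T j).filter p) =
      #((univ.filter fun c : ↥(skewCells lam mu) => c.1.2 = j ∧ p (T c)).image fun c => c.1.1) := by
  rw [column_eq_image, filter_image, filter_filter, card_image_of_injOn, card_image_of_injOn]
  · intro c hc d hd h
    simp only [coe_filter, mem_univ, true_and, Set.mem_ofPred_eq] at hc hd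
    exact Subtype.ext (Prod.ext h (hc.1.trans hd.1.symm))
  · intro c hc d hd h
    simp only [coe_filter, mem_univ, true_and, Set.mem_ofPred_eq] at hc hd
    exact hT.injOn j hc.1 hd.1 h

theorem ColStrict.card_column {T : Filling lam mu m} (hT : ColStrict T) (j : ℕ) :
    #(column T j) = lam.colLen j - mu.colLen j := by
  have h := hT.card_filter_column j (fun _ => True)
  rw [filter_true_of_mem fun _ _ => trivial] at h
  rw [h, ← Nat.card_Ico]
  congr 1
  ext i
  simp only [and_true, mem_image, mem_filter, mem_univ, true_and, mem_Ico]
  constructor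
  · rintro ⟨c, rfl, rfl⟩
    exact cell_bounds c
  · intro hi
    exact ⟨⟨(i, j), mem_skewCells.2 hi⟩, rfl, rfl⟩

/-- In a strictly increasing column, an entry is at most `x` exactly when its position is at most the
number of entries that are at most `x`. -/
theorem ColStrict.le_iff {T : Filling lam mu m} (hT : ColStrict T) (c : ↥(skewCells lam mu))
    (x : Letter m) :
    T c ≤ x ↔ c.1.1 < mu.colLen c.1.2 + #((column T c.1.2).filter fun a => a ≤ x) := by
  rw [hT.card_filter_column]
  have hb := cell_bounds c
  constructor
  · intro h
    have : Ico (mu.colLen c.1.2) (c.1.1 + 1) ⊆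
        (univ.filter fun d : ↥(skewCells lam mu) => d.1.2 = c.1.2 ∧ T d ≤ x).image fun d => d.1.1 := by
      intro i hi
      rw [mem_Ico] at hi
      refine mem_image.2 ⟨⟨(i, c.1.2), mem_skewCells.2 ⟨hi.1, by omega⟩⟩, ?_, rfl⟩
      refine mem_filter.2 ⟨mem_univ _, rfl, ?_⟩
      rcases (Nat.lt_succ_iff.1 hi.2).lt_or_eq with h1 | h1
      · exact (hT ⟨(i, c.1.2), mem_skewCells.2 ⟨hi.1, by omega⟩⟩ c rfl h1).le.trans h
      · subst h1; exact h
    have := card_le_card this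
    rw [Nat.card_Ico] at this
    omega
  · intro h
    by_contra hx
    have : ((univ.filter fun d : ↥(skewCells lam mu) => d.1.2 = c.1.2 ∧ T d ≤ x).image
        fun d => d.1.1) ⊆ Ico (mu.colLen c.1.2) c.1.1 := by
      intro i hi
      obtain ⟨d, hd, rfl⟩ := mem_image.1 hi
      obtain ⟨h1, h2⟩ := (mem_filter.1 hd).2
      have hdb := cell_bounds d
      rw [h1] at hdb
      refine mem_Ico.2 ⟨hdb.1, ?_⟩
      by_contra h3
      apply hx
      rcases (not_lt.1 h3).lt_or_eq with h4 | h4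
      · exact (hT c d h1.symm h4).le.trans h2
      · rwa [show c = d from Subtype.ext (Prod.ext h4 h1.symm)]
    have := card_le_card this
    rw [Nat.card_Ico] at this
    omega

theorem ColStrict.ext_column {T T' : Filling lam mu m} (hT : ColStrict T) (hT' : ColStrict T')
    (h : ∀ j, column T j = column T' j) : T = T' := by
  funext c
  refine eq_of_forall_ge_iff fun x => ?_
  rw [hT.le_iff, hT'.le_iff, h]

theorem exists_colStrict_column_eq {C : ℕ → Finset (Letter m)}
    (hC : ∀ j, #(C j) = lam.colLen j - mu.colLen j) :
    ∃ T : Filling lam mu m, ColStrict T ∧ ∀ j, column T j = C j := by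
  let T : Filling lam mu m := fun c =>
    (C c.1.2).orderEmbOfFin (hC _) ⟨c.1.1 - mu.colLen c.1.2, by have := cell_bounds c; omega⟩
  have hT : ColStrict T := by
    rintro ⟨⟨i, j⟩, hc⟩ ⟨⟨i', j'⟩, hd⟩ hj hi
    simp only at hj hi
    subst hj
    have := mem_skewCells.1 hc
    simp only [T, OrderEmbedding.lt_iff_lt, Fin.mk_lt_mk]
    omega
  refine ⟨T, hT, ?_⟩
  · intro j
    rw [column_eq_image]
    apply eq_of_subset_of_card_le
    · intro a ha
      obtain ⟨⟨⟨i, j'⟩, hc⟩, h1, rfl⟩ := mem_image.1 ha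
      simp only [mem_filter, mem_univ, true_and] at h1
      subst h1
      exact orderEmbOfFin_mem _ _ _
    · rw [← column_eq_image, hT.card_column, hC]
      
/-- Comparing two columns row by row amounts to comparing, for every letter `x`, the numbers of entries
that are at most `x`, up to the vertical offset of the columns. -/
theorem rows_le_iff {P Q : Filling lam mu m} (hP : ColStrict P) (hQ : ColStrict Q) {j j' : ℕ}
    (hj : j ≤ j') :
    (∀ c d : ↥(skewCells lam mu), c.1.1 = d.1.1 → c.1.2 = j → d.1.2 = j' → P c ≤ Q d) ↔
    ∀ x, #((column Q j').filter fun a => a ≤ x) ≤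
      #((column P j).filter fun a => a ≤ x) + (mu.colLen j - mu.colLen j') := by
  have hmu := mu.colLen_anti _ _ hj
  have hlam := lam.colLen_anti _ _ hj
  constructor
  · intro h x
    by_contra hlt
    have hle : #((column Q j').filter fun a => a ≤ x) ≤ lam.colLen j' - mu.colLen j' :=
      (card_filter_le _ _).trans (hQ.card_column j').le
    -- the lowest box of column `j'` with entry at most `x`
    set i := mu.colLen j' + #((column Q j').filter fun a => a ≤ x) - 1 with hi
    have h1 : (i, j') ∈ skewCells lam mu := mem_skewCells.2 (by omega)
    have h2 : (i, j) ∈ skewCells lam mu := mem_skewCells.2 (by omega)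
    have h3 := (hQ.le_iff ⟨_, h1⟩ x).2 (by dsimp only; omega)
    have h4 := (hP.le_iff ⟨_, h2⟩ x).1 ((h ⟨_, h2⟩ ⟨_, h1⟩ rfl rfl rfl).trans h3)
    dsimp only at h4
    omega
  · intro h c d hrow hc hd
    have h1 := (hQ.le_iff d (Q d)).1 le_rfl
    rw [hP.le_iff]
    rw [hd] at h1
    rw [hc, hrow]
    have := h (Q d)
    omega

theorem ColStrict.prod_eq {T : Filling lam mu m} (hT : ColStrict T) {N : ℕ}
    (hN : lam.rowLen 0 ≤ N) {M : Type*} [CommMonoid M] (y : Letter m → M) :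
    ∏ c, y (T c) = ∏ j : Fin N, ∏ a ∈ column T j, y a := by
  rw [Fin.prod_univ_eq_prod_range (fun j => ∏ a ∈ column T j, y a),
    ← prod_fiberwise_of_maps_to (s := univ) (t := range N)
      (g := fun c : ↥(skewCells lam mu) => c.1.2)]
  · refine prod_congr rfl fun j _ => ?_
    rw [column_eq_image, prod_image]
    intro c hc d hd h
    simp only [coe_filter, mem_univ, true_and, Set.mem_ofPred_eq] at hc hd
    exact hT.injOn j hc hd h
  · intro c _
    have h1 : (c.1.1, c.1.2) ∈ lam := by
      rw [YoungDiagram.mem_iff_lt_colLen]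
      exact (cell_bounds c).2
    have h2 := YoungDiagram.mem_iff_lt_rowLen.1 h1
    have h3 := lam.rowLen_anti 0 c.1.1 (Nat.zero_le _)
    exact mem_range.2 (by omega)

/-! ### Semistandardness in terms of states -/

/-- The numbers of signs `1` and of signs `-1` before level `v`. -/
def signSum (p : Fin m → SignType) (v : ℕ) : ℤ × ℤ :=
  ∑ u : Fin m, if (u : ℕ) < v then Step.signVec (p u) else 0

theorem signSum_fst (p : Fin m → SignType) (v : ℕ) :
    (signSum p v).1 = #{u : Fin m | p u = 1 ∧ (u : ℕ) < v} := by
  rw [signSum, Prod.fst_sum, card_filter]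
  push_cast
  refine sum_congr rfl fun u _ => ?_
  cases p u <;> by_cases h : (u : ℕ) < v <;> simp [h, Step.signVec]

theorem signSum_snd (p : Fin m → SignType) (v : ℕ) :
    (signSum p v).2 = #{u : Fin m | p u = -1 ∧ (u : ℕ) < v} := by
  rw [signSum, Prod.snd_sum, card_filter]
  push_cast
  refine sum_congr rfl fun u _ => ?_
  cases p u <;> by_cases h : (u : ℕ) < v <;> simp [h, Step.signVec]

theorem card_filter_letters (P Q : Finset (Fin m)) (r : Letter m → Prop) [DecidablePred r] :
    #((letters P Q).filter r) =
      #(P.filter fun v => r (unbarred v)) + #(Q.filter fun v => r (barred v)) := by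
  rw [letters, filter_union, filter_image, filter_image, card_union_of_disjoint,
    card_image_of_injective _ unbarred_injective, card_image_of_injective _ barred_injective]
  rw [disjoint_left]
  intro a ha hb
  obtain ⟨u, _, rfl⟩ := mem_image.1 ha
  obtain ⟨v, _, h⟩ := mem_image.1 hb
  exact unbarred_ne_barred u v h.symm

theorem card_letters (P Q : Finset (Fin m)) : #(letters P Q) = #P + #Q := by
  simpa using card_filter_letters P Q fun _ => True

theorem card_signCol (p : Fin m → SignType) :
    (#(signCol p) : ℤ) = (signSum p m).1 + (signSum p m).2 := by
  rw [signCol, card_letters, signSum_fst, signSum_snd]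
  simp

theorem card_signCol_le_unbarred (p : Fin m → SignType) (v : Fin m) :
    (#((signCol p).filter fun a => a ≤ unbarred v) : ℤ) = (signSum p (v + 1)).1 := by
  rw [signCol, card_filter_letters, signSum_fst, filter_filter, filter_filter]
  have h1 : (univ.filter fun u : Fin m => p u = -1 ∧ barred u ≤ unbarred v) = ∅ := by
    refine filter_eq_empty_iff.2 fun u _ h => ?_
    have h2 := h.2
    simp only [barred, unbarred, Fin.mk_le_mk] at h2
    have := u.isLt
    have := v.isLt
    omega
  rw [h1, card_empty, add_zero]
  congr 2
  ext u
  simp [unbarred]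

theorem card_signCol_le_barred (p : Fin m → SignType) (v : Fin m) :
    (#((signCol p).filter fun a => a ≤ barred v) : ℤ) = #(signCol p) - (signSum p v).2 := by
  have h1 := card_filter_add_card_filter_not (s := signCol p) fun a => a ≤ barred v
  have h2 : (#((signCol p).filter fun a => ¬ a ≤ barred v) : ℤ) = (signSum p v).2 := by
    rw [signCol, card_filter_letters, signSum_snd, filter_filter, filter_filter]
    have h3 : (univ.filter fun u : Fin m => p u = 1 ∧ ¬ unbarred u ≤ barred v) = ∅ := by
      refine filter_eq_empty_iff.2 fun u _ h => h.2 ?_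
      simp only [barred, unbarred, Fin.mk_le_mk]
      have := u.isLt
      have := v.isLt
      omega
    rw [h3, card_empty, zero_add]
    congr 2
    ext u
    simp only [mem_filter, mem_univ, true_and, not_le, barred, Fin.mk_lt_mk]
    have := u.isLt
    have := v.isLt
    constructor <;> rintro ⟨a, b⟩ <;> exact ⟨a, by omega⟩
  omega

/-- The comparison of two columns in the sense of `rows_le_iff`, expressed by levels: the letters up to
`v` count the unbarred letters, and those up to `v̄` miss only the barred letters below index `v`. -/
theorem card_le_iff_signSum_le {p q : Fin m → SignType} {δ : ℕ}
    (h0 : #(signCol q) ≤ #(signCol p) + δ) :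
    (∀ x, #((signCol q).filter fun a => a ≤ x) ≤ #((signCol p).filter fun a => a ≤ x) + δ) ↔
    ∀ v ≤ m, (signSum q v).1 ≤ (signSum p v).1 + δ ∧
      (signSum p v).2 ≤ (signSum q v).2 + ((#(signCol p) : ℤ) + δ - #(signCol q)) := by
  have zero : ∀ p : Fin m → SignType, signSum p 0 = 0 := fun p => by simp [signSum]
  constructor
  · intro h
    have hU : ∀ v ≤ m, (signSum q v).1 ≤ (signSum p v).1 + δ := by
      intro v hv
      cases v with
      | zero => simp [zero]
      | succ v =>
        have := h (unbarred ⟨v, hv⟩)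
        have h1 := card_signCol_le_unbarred p ⟨v, hv⟩
        have h2 := card_signCol_le_unbarred q ⟨v, hv⟩
        dsimp only at h1 h2
        omega
    intro v hv
    refine ⟨hU v hv, ?_⟩
    rcases hv.lt_or_eq with hv | rfl
    · have := h (barred ⟨v, hv⟩)
      have h1 := card_signCol_le_barred p ⟨v, hv⟩
      have h2 := card_signCol_le_barred q ⟨v, hv⟩
      dsimp only at h1 h2
      omega
    · have := hU v le_rfl
      rw [card_signCol, card_signCol]
      omega
  · intro h x
    obtain ⟨v, rfl⟩ | ⟨v, rfl⟩ := eq_unbarred_or_barred x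
    · have := (h (v + 1) v.isLt).1
      rw [← card_signCol_le_unbarred, ← card_signCol_le_unbarred] at this
      omega
    · have := (h v v.isLt.le).2
      have h1 := card_signCol_le_barred p v
      have h2 := card_signCol_le_barred q v
      omega

theorem after_apply (w : Fin m → Fin (n + 1) → Step) (v : ℕ) (j : Fin (n + 1)) :
    (0 : State n).after w v j =
      (signSum (fun u => (w u j).left) v, signSum (fun u => (w u j).right) v) := by
  simp only [State.after, Pi.zero_apply, zero_add, signSum]
  rw [Prod.ext_iff, Prod.fst_sum, Prod.snd_sum]
  constructor <;> refine sum_congr rfl fun u _ => ?_ <;> split_ifs <;> rfl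

theorem after_next (σ : State n) (w : Fin m → Fin (n + 1) → Step) (v : Fin m) :
    (σ.after w v).next (w v) = σ.after w (v + 1) := by
  funext j
  simp only [State.after, State.next, add_assoc]
  congr 1
  have h : ∀ u : Fin m, (if (u : ℕ) < v + 1 then (w u j).disp else 0) =
      (if (u : ℕ) < v then (w u j).disp else 0) + if u = v then (w u j).disp else 0 := by
    intro u
    by_cases h : u = v
    · simp [h]
    · have : (u : ℕ) < v + 1 ↔ (u : ℕ) < v := by omega
      simp [h, this]
  rw [sum_congr rfl fun u _ => h u, sum_add_distrib]
  simp

theorem signSum_left_right (s : Fin m → Step) (v : ℕ) :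
    (signSum (fun u => (s u).left) v).1 - (signSum (fun u => (s u).right) v).1 = height s v ∧
    (signSum (fun u => (s u).right) v).2 - (signSum (fun u => (s u).left) v).2 = height s v := by
  simp only [signSum, height, Prod.fst_sum, Prod.snd_sum, ← sum_sub_distrib]
  constructor <;> refine sum_congr rfl fun u _ => ?_ <;> split_ifs <;> cases s u <;>
    simp [Step.left, Step.right, Step.signVec, Step.rise]

theorem Balanced.height_nonneg {s : Fin m → Step} (hs : Balanced s) {v : ℕ} (hv : v ≤ m) :
    0 ≤ height s v := by
  cases v with
  | zero => simp [height]
  | succ v => exact hs.nonneg ⟨v, hv⟩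

theorem Balanced.card_right {s : Fin m → Step} (hs : Balanced s) :
    #(signCol fun v => (s v).right) = #(signCol fun v => (s v).left) := by
  have h := signSum_left_right s m
  rw [hs.total] at h
  have h1 := card_signCol fun v => (s v).right
  have h2 := card_signCol fun v => (s v).left
  omega

theorem Balanced.card_wordCol {s : Fin m → Step} (hs : Balanced s) :
    #(wordCol s) = #(signCol fun v => (s v).left) := by
  have h := hs.total
  rw [height] at h
  rw [wordCol, signCol, card_letters, card_letters]
  zify
  rw [← sub_eq_zero, ← neg_eq_zero, ← h]
  simp only [card_filter]
  push_cast
  rw [← sum_add_distrib, ← sum_add_distrib, ← sum_sub_distrib, ← sum_neg_distrib]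
  refine sum_congr rfl fun u _ => ?_
  rw [if_pos u.isLt]
  cases s u <;> simp [Step.left, Step.rise]

theorem Balanced.card_filter_right_le {s : Fin m → Step} (hs : Balanced s) (x : Letter m) :
    #((signCol fun v => (s v).right).filter fun a => a ≤ x) ≤
      #((signCol fun v => (s v).left).filter fun a => a ≤ x) := by
  have := (card_le_iff_signSum_le (p := fun v => (s v).left) (q := fun v => (s v).right) (δ := 0)
    hs.card_right.le).2 ?_ x
  · simpa using this
  intro v hv
  have h1 := signSum_left_right s v
  have h2 := hs.height_nonneg hv
  rw [hs.card_right]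
  push_cast
  constructor <;> omega

/-- Valid words are families of balanced words, with columns of the prescribed heights, satisfying the
row condition between adjacent columns. -/
theorem validFrom_zero_iff (hm : 1 ≤ m) {k : Fin (n + 1) → ℕ} {δ : Fin n → ℕ}
    (hk : ∀ i : Fin n, k i.succ ≤ k i.castSucc + δ i) (w : Fin m → Fin (n + 1) → Step) :
    ValidFrom (fun i => (δ i : ℤ)) (fun i => (k i.castSucc : ℤ) + δ i - k i.succ)
      (fun j => (k j : ℤ)) 0 w ↔
    (∀ j, Balanced fun v => w v j) ∧ (∀ j, #(signCol fun v => (w v j).left) = k j) ∧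
    ∀ (i : Fin n) (x : Letter m),
      #((signCol fun v => (w v i.succ).left).filter fun a => a ≤ x) ≤
        #((signCol fun v => (w v i.castSucc).right).filter fun a => a ≤ x) + δ i := by
  constructor
  · intro h
    have good : ∀ v ≤ m, Good (fun i => (δ i : ℤ)) (fun i => (k i.castSucc : ℤ) + δ i - k i.succ)
        ((0 : State n).after w v) := by
      intro v hv
      cases v with
      | zero => exact (h.allowed ⟨0, hm⟩).source
      | succ v =>
        have := (h.allowed ⟨v, hv⟩).target
        rwa [after_next] at this
    have bal : ∀ j, Balanced fun v => w v j := by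
      intro j
      refine ⟨fun v => ?_, fun v hv => ?_, ?_⟩
      · have := (good (v + 1) v.isLt).height j
        rw [after_apply] at this
        have h1 := signSum_left_right (fun v => w v j) (v + 1)
        dsimp only at this h1
        omega
      · have := (h.allowed v).none_height j hv
        rw [after_apply] at this
        have h1 := signSum_left_right (fun v => w v j) v
        dsimp only at this h1
        omega
      · have := congrArg Prod.fst (h.final.eq j)
        rw [after_apply] at this
        have h1 := signSum_left_right (fun v => w v j) m
        dsimp only at this h1
        omega
    have card : ∀ j, #(signCol fun v => (w v j).left) = k j := by
      intro j
      have := h.final.sum j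
      rw [after_apply] at this
      have h1 := card_signCol fun v => (w v j).left
      dsimp only at this
      omega
    refine ⟨bal, card, fun i => ?_⟩
    refine (card_le_iff_signSum_le ?_).2 fun v hv => ?_
    · rw [(bal _).card_right, card, card]
      exact hk i
    · have h1 := (good v hv).unbar i
      have h2 := (good v hv).bar i
      rw [after_apply, after_apply] at h1 h2
      rw [(bal _).card_right, card, card]
      exact ⟨h1, h2⟩
  · rintro ⟨bal, card, adj⟩
    have good : ∀ v ≤ m, Good (fun i => (δ i : ℤ)) (fun i => (k i.castSucc : ℤ) + δ i - k i.succ)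
        ((0 : State n).after w v) := by
      intro v hv
      have adj' : ∀ i : Fin n, _ := fun i => (card_le_iff_signSum_le (by
        rw [(bal _).card_right, card, card]
        exact hk i)).1 (adj i) v hv
      refine ⟨fun j => ?_, fun i => ?_, fun i => ?_⟩
      · have h1 := signSum_left_right (fun v => w v j) v
        have h2 := (bal j).height_nonneg hv
        rw [after_apply]
        dsimp only at h1 ⊢
        omega
      · rw [after_apply, after_apply]
        exact (adj' i).1
      · have := (adj' i).2
        rw [(bal _).card_right, card, card] at this
        rw [after_apply, after_apply]
        exact this
    refine ⟨fun v => ⟨good v v.isLt.le, ?_, fun j hj => ?_⟩, fun j => ?_, fun j => ?_⟩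
    · rw [after_next]
      exact good (v + 1) v.isLt
    · have h1 := signSum_left_right (fun v => w v j) v
      have h2 := (bal j).none_zero v hj
      rw [after_apply]
      dsimp only at h1 ⊢
      omega
    · have h1 := signSum_left_right (fun v => w v j) m
      have h2 := (bal j).total
      rw [after_apply]
      refine Prod.ext ?_ ?_ <;> dsimp only at h1 ⊢ <;> omega
    · rw [after_apply]
      dsimp only
      rw [← card_signCol, card]

/-! ### Tableaux and words -/

theorem prod_letters {M : Type*} [CommMonoid M] (P Q : Finset (Fin m)) (y : Letter m → M) :
    ∏ a ∈ letters P Q, y a = (∏ v ∈ P, y (unbarred v)) * ∏ v ∈ Q, y (barred v) := by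
  rw [letters, prod_union, prod_image unbarred_injective.injOn, prod_image barred_injective.injOn]
  rw [disjoint_left]
  intro a ha hb
  obtain ⟨u, _, rfl⟩ := mem_image.1 ha
  obtain ⟨v, _, h⟩ := mem_image.1 hb
  exact unbarred_ne_barred u v h.symm

theorem letters_univ : letters (univ : Finset (Fin m)) univ = univ :=
  letter_ext (by simp) (by simp)

/-- The letter `v` has the value `x v`, and `v̄` has the value `(x v)⁻¹`. -/
def letterValue (x : Fin m → ℂˣ) (a : Letter m) : ℂˣ :=
  if h : (a : ℕ) < m then x ⟨a, h⟩
  else (x ⟨2 * m - 1 - a, by have := a.isLt; omega⟩)⁻¹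

@[simp] theorem letterValue_unbarred (x : Fin m → ℂˣ) (v : Fin m) :
    letterValue x (unbarred v) = x v := by
  simp [letterValue, unbarred]

@[simp] theorem letterValue_barred (x : Fin m → ℂˣ) (v : Fin m) :
    letterValue x (barred v) = (x v)⁻¹ := by
  have := v.isLt
  have h : ¬ (2 * m - 1 - (v : ℕ)) < m := by omega
  simp only [letterValue, barred, h, ↓reduceDIte]
  congr 2
  refine Fin.ext ?_
  change 2 * m - 1 - (2 * m - 1 - (v : ℕ)) = v
  omega

theorem prod_wordCol (x : Fin m → ℂˣ) (s : Fin m → Step) :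
    ∏ a ∈ wordCol s, letterValue x a = ∏ v, x v ^ (s v).wt := by
  rw [wordCol, prod_letters, prod_filter, prod_filter, ← prod_mul_distrib]
  refine prod_congr rfl fun v _ => ?_
  cases h : s v <;> simp [Step.wt]

/-- The columns of `T` are those described by the word `w`. -/
def IsWordOf {n : ℕ} (T : Filling lam mu m) (w : Fin m → Fin (n + 1) → Step) : Prop :=
  ColStrict T ∧ ∀ j : Fin (n + 1), column T j = wordCol fun v => w v j

theorem ColStrict.column_eq_empty {T : Filling lam mu m} (hT : ColStrict T) {j : ℕ}
    (hj : lam.rowLen 0 ≤ j) : column T j = ∅ := by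
  rw [← card_eq_zero, hT.card_column]
  have : ¬ (0, j) ∈ lam := fun h => by
    have := YoungDiagram.mem_iff_lt_rowLen.1 h
    omega
  rw [YoungDiagram.mem_iff_lt_colLen] at this
  omega

theorem colLen_eq_zero {j : ℕ} (hj : lam.rowLen 0 ≤ j) : lam.colLen j = 0 := by
  have : ¬ (0, j) ∈ lam := fun h => by
    have := YoungDiagram.mem_iff_lt_rowLen.1 h
    omega
  rw [YoungDiagram.mem_iff_lt_colLen] at this
  omega

variable (lam mu) in
/-- The height of column `j` of `lam / mu`. -/
def colHeight (j : ℕ) : ℕ := lam.colLen j - mu.colLen j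

variable (mu) in
/-- The offset between the tops of the columns `j` and `j + 1` of `lam / mu`. -/
def colShift (j : ℕ) : ℕ := mu.colLen j - mu.colLen (j + 1)

theorem colHeight_succ_le (hsub : mu ≤ lam) (j : ℕ) :
    colHeight lam mu (j + 1) ≤ colHeight lam mu j + colShift mu j := by
  have h1 := lam.colLen_anti j (j + 1) (by omega)
  have h2 := mu.colLen_anti j (j + 1) (by omega)
  have h3 : mu.colLen j ≤ lam.colLen j := by
    by_contra h
    have : (lam.colLen j, j) ∈ mu := YoungDiagram.mem_iff_lt_colLen.2 (by omega)
    have := YoungDiagram.mem_iff_lt_colLen.1 (hsub this)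
    omega
  unfold colHeight colShift
  omega

variable (lam mu) in
/-- The words of the tableaux of shape `lam / mu`. One column more than the shape has is used, so that
the number of columns is positive; the last column is empty. -/
def ValidWord (w : Fin m → Fin (lam.rowLen 0 + 1) → Step) : Prop :=
  ValidFrom (fun i : Fin (lam.rowLen 0) => (colShift mu i : ℤ))
    (fun i => (colHeight lam mu i : ℤ) + colShift mu i - colHeight lam mu (i + 1))
    (fun j => (colHeight lam mu j : ℤ)) 0 w

theorem validWord_iff (hsub : mu ≤ lam) (hm : 1 ≤ m) (w : Fin m → Fin (lam.rowLen 0 + 1) → Step) :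
    ValidWord lam mu w ↔
    (∀ j, Balanced fun v => w v j) ∧ (∀ j, #(signCol fun v => (w v j).left) = colHeight lam mu j) ∧
    ∀ (i : Fin (lam.rowLen 0)) (x : Letter m),
      #((signCol fun v => (w v i.succ).left).filter fun a => a ≤ x) ≤
        #((signCol fun v => (w v i.castSucc).right).filter fun a => a ≤ x) + colShift mu i :=
  validFrom_zero_iff hm (k := fun j => colHeight lam mu j) (δ := fun i => colShift mu i)
    (fun i => colHeight_succ_le hsub i) w

theorem exists_isWordOf_of_isKN (hsub : mu ≤ lam) (hm : 1 ≤ m) {T : Filling lam mu m}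
    (hT : IsKN T) : ∃ w : Fin m → Fin (lam.rowLen 0 + 1) → Step,
      ValidWord lam mu w ∧ IsWordOf T w := by
  obtain ⟨hcol, _, L, R, hL, hR, hsplit, _, hrow⟩ := hT
  choose s hbal hC hD hE using fun j => (hsplit j).exists_balanced
  refine ⟨fun v j => s j v, (validWord_iff hsub hm _).2 ⟨fun j => hbal j, fun j => ?_, fun i x => ?_⟩,
    hcol, fun j => hC j⟩
  · rw [← hD, hL.card_column, colHeight]
  · have := (rows_le_iff hR hL (Nat.le_succ (i : ℕ))).1
      (fun c d h1 h2 h3 => hrow c d h1 (by rw [h3, h2])) x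
    rw [hD, hE] at this
    exact this

/-- The extension of a finite family of columns by empty columns. -/
def extendColumns {N : ℕ} (F : Fin N → Finset (Letter m)) (j : ℕ) : Finset (Letter m) :=
  if h : j < N then F ⟨j, h⟩ else ∅

theorem extendColumns_of_lt {N : ℕ} (F : Fin N → Finset (Letter m)) {j : ℕ} (h : j < N) :
    extendColumns F j = F ⟨j, h⟩ := dif_pos h

theorem extendColumns_of_not_lt {N : ℕ} (F : Fin N → Finset (Letter m)) {j : ℕ} (h : ¬ j < N) :
    extendColumns F j = ∅ := dif_neg h

theorem exists_isKN_isWordOf (hsub : mu ≤ lam) (hm : 1 ≤ m)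
    {w : Fin m → Fin (lam.rowLen 0 + 1) → Step} (hw : ValidWord lam mu w) :
    ∃ T : Filling lam mu m, IsKN T ∧ IsWordOf T w := by
  obtain ⟨bal, card, adj⟩ := (validWord_iff hsub hm w).1 hw
  have fill : ∀ F : Fin (lam.rowLen 0 + 1) → Finset (Letter m),
      (∀ j, #(F j) = colHeight lam mu j) →
      ∃ T : Filling lam mu m, ColStrict T ∧ ∀ j, column T j = extendColumns F j := by
    intro F hF
    refine exists_colStrict_column_eq fun j => ?_
    by_cases h : j < lam.rowLen 0 + 1
    · rw [extendColumns_of_lt F h, hF]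
      rfl
    · rw [extendColumns_of_not_lt F h, colLen_eq_zero (by omega)]
      simp
  obtain ⟨T, hT, hTc⟩ := fill (fun j => wordCol fun v => w v j)
    (fun j => by rw [(bal j).card_wordCol, card])
  obtain ⟨L, hL, hLc⟩ := fill (fun j => signCol fun v => (w v j).left) card
  obtain ⟨R, hR, hRc⟩ := fill (fun j => signCol fun v => (w v j).right)
    (fun j => by rw [(bal j).card_right, card])
  refine ⟨T, ⟨hT, fun j => ?_, L, R, hL, hR, fun j => ?_, fun c => ?_, fun c d hrow hcol => ?_⟩,
    hT, fun j => ?_⟩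
  · rw [hTc]
    by_cases h : j < lam.rowLen 0 + 1
    · rw [extendColumns_of_lt _ h]
      exact (bal _).admissible
    · rw [extendColumns_of_not_lt _ h]
      intro i hi
      simp at hi
  · rw [hTc, hLc, hRc]
    by_cases h : j < lam.rowLen 0 + 1
    · rw [extendColumns_of_lt _ h, extendColumns_of_lt _ h, extendColumns_of_lt _ h]
      exact (bal _).isSplit
    · rw [extendColumns_of_not_lt _ h, extendColumns_of_not_lt _ h, extendColumns_of_not_lt _ h]
      refine ⟨id, ?_, ?_, ?_⟩ <;> simp [pairs]
  · refine (rows_le_iff hL hR (le_refl c.1.2)).2 (fun x => ?_) c c rfl rfl rfl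
    rw [hLc, hRc]
    by_cases h : c.1.2 < lam.rowLen 0 + 1
    · rw [extendColumns_of_lt _ h, extendColumns_of_lt _ h]
      have := (bal ⟨_, h⟩).card_filter_right_le x
      omega
    · rw [extendColumns_of_not_lt _ h]
      simp
  · refine (rows_le_iff hR hL (Nat.le_succ c.1.2)).2 (fun x => ?_) c d hrow rfl hcol
    rw [hLc, hRc]
    by_cases h : c.1.2 < lam.rowLen 0
    · rw [extendColumns_of_lt _ (show c.1.2.succ < lam.rowLen 0 + 1 by omega),
        extendColumns_of_lt _ (show c.1.2 < lam.rowLen 0 + 1 by omega)]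
      exact adj ⟨c.1.2, h⟩ x
    · rw [extendColumns_of_not_lt _ (show ¬ c.1.2.succ < lam.rowLen 0 + 1 by omega)]
      simp
  · rw [hTc, extendColumns_of_lt _ j.isLt]

theorem IsWordOf.prod_letterValue {T : Filling lam mu m}
    {w : Fin m → Fin (lam.rowLen 0 + 1) → Step} (h : IsWordOf T w) (x : Fin m → ℂˣ) :
    ∏ c, letterValue x (T c) = ∏ v, ∏ j, x v ^ (w v j).wt := by
  rw [h.1.prod_eq (Nat.le_succ _), prod_comm]
  refine prod_congr rfl fun j _ => ?_
  rw [h.2, prod_wordCol]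

/-- The character of `SP lam mu m`, evaluated at `x`. -/
noncomputable def charSum (lam mu : YoungDiagram) (m : ℕ) (x : Fin m → ℂˣ) : ℂ :=
  ∑ T ∈ SP lam mu m, ((∏ c, letterValue x (T c) : ℂˣ) : ℂ)

theorem charSum_eq_wordSum (hsub : mu ≤ lam) (hm : 1 ≤ m) (x : Fin m → ℂˣ) :
    charSum lam mu m x = wordSum (fun i : Fin (lam.rowLen 0) => (colShift mu i : ℤ))
      (fun i => (colHeight lam mu i : ℤ) + colShift mu i - colHeight lam mu (i + 1))
      (fun j => (colHeight lam mu j : ℤ)) x := by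
  classical
  rw [wordSum, foldr_transfer_eq_sum, ← sum_filter, charSum]
  have kn : ∀ T, T ∈ SP lam mu m ↔ IsKN T := fun T => by simp [SP]
  choose w hw using fun (T : Filling lam mu m) (hT : T ∈ SP lam mu m) =>
    exists_isWordOf_of_isKN hsub hm ((kn T).1 hT)
  refine sum_bij w (fun T hT => mem_filter.2 ⟨mem_univ _, (hw T hT).1⟩) ?_ ?_ ?_
  · intro T hT T' hT' h
    have h1 := (hw T hT).2
    have h2 := (hw T' hT').2
    rw [← h] at h2
    refine h1.1.ext_column h2.1 fun j => ?_
    by_cases hj : j < lam.rowLen 0 + 1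
    · exact (h1.2 ⟨j, hj⟩).trans (h2.2 ⟨j, hj⟩).symm
    · rw [h1.1.column_eq_empty (by omega), h2.1.column_eq_empty (by omega)]
  · intro u hu
    have hu' : ValidWord lam mu u := (mem_filter.1 hu).2
    obtain ⟨T, hT, hTu⟩ := exists_isKN_isWordOf hsub hm hu'
    refine ⟨T, (kn T).2 hT, ?_⟩
    obtain ⟨v1, v2⟩ := hw T ((kn T).2 hT)
    funext v j
    have := ((validWord_iff hsub hm _).1 v1).1 j
    exact congrFun (this.ext_of_wordCol (((validWord_iff hsub hm _).1 hu').1 j)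
      ((v2.2 j).symm.trans (hTu.2 j))) v
  · intro T hT
    rw [(hw T hT).2.prod_letterValue]
    push_cast
    rfl

theorem charSum_perm (hsub : mu ≤ lam) (x : Fin m → ℂˣ) (π : Equiv.Perm (Fin m)) :
    charSum lam mu m (x ∘ π) = charSum lam mu m x := by
  rcases Nat.eq_zero_or_pos m with rfl | hm
  · congr 1
    exact Subsingleton.elim _ _
  · rw [charSum_eq_wordSum hsub hm, charSum_eq_wordSum hsub hm, wordSum_perm]

theorem charSum_update_inv (hsub : mu ≤ lam) (x : Fin m → ℂˣ) (i : Fin m) :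
    charSum lam mu m (Function.update x i (x i)⁻¹) = charSum lam mu m x := by
  have hm : 1 ≤ m := by have := i.isLt; omega
  rw [charSum_eq_wordSum hsub hm, charSum_eq_wordSum hsub hm, wordSum_update_inv]
  intro i
  simp

/-! ### Orbit sums of the hyperoctahedral group -/

theorem prod_filling_eq {M : Type*} [CommMonoid M] (T : Filling lam mu m) (y : Letter m → M) :
    ∏ c, y (T c) = ∏ v, (y (unbarred v) ^ count T (unbarred v) *
      y (barred v) ^ count T (barred v)) := by
  rw [prod_mul_distrib, ← prod_letters univ univ fun a => y a ^ count T a, letters_univ,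
    ← prod_fiberwise univ T]
  refine prod_congr rfl fun a _ => ?_
  rw [prod_congr rfl (g := fun _ => y a) fun c hc => by rw [(mem_filter.1 hc).2], prod_const]
  rfl

theorem sum_count (T : Filling lam mu m) :
    ∑ v, (count T (unbarred v) + count T (barred v)) = #(skewCells lam mu) := by
  have := prod_filling_eq T fun _ => Multiplicative.ofAdd 1
  apply Multiplicative.ofAdd.injective
  rw [ofAdd_sum]
  simp only [ofAdd_add]
  simpa [← ofAdd_nsmul] using this.symm

/-- The exponent of `x_v` in the monomial of `T`. -/
def weight (T : Filling lam mu m) (v : Fin m) : ℤ := count T (unbarred v) - count T (barred v)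

theorem prod_letterValue_eq (x : Fin m → ℂˣ) (T : Filling lam mu m) :
    ∏ c, letterValue x (T c) = ∏ v, x v ^ weight T v := by
  rw [prod_filling_eq]
  refine prod_congr rfl fun v _ => ?_
  rw [letterValue_unbarred, letterValue_barred, weight, zpow_sub, zpow_natCast, zpow_natCast,
    inv_pow]

theorem sum_abs_weight_le (T : Filling lam mu m) :
    ∑ v, |weight T v| ≤ #(skewCells lam mu) := by
  rw [← sum_count T]
  push_cast
  refine sum_le_sum fun v _ => ?_
  unfold weight
  rw [abs_le]
  constructor <;> omega

theorem odd_sum_weight (T : Filling lam mu m) (h : Odd #(skewCells lam mu)) :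
    Odd (∑ v, weight T v) := by
  have h1 : ∑ v, weight T v =
      (#(skewCells lam mu) : ℤ) - 2 * ∑ v, (count T (barred v) : ℤ) := by
    rw [← sum_count T, mul_sum]
    push_cast
    rw [← sum_sub_distrib]
    refine sum_congr rfl fun v _ => ?_
    unfold weight
    ring
  rw [h1]
  exact ((Int.odd_coe_nat _).2 h).sub_even (even_two_mul _)

theorem charSum_inv_on (hsub : mu ≤ lam) (x : Fin m → ℂˣ) (S : Finset (Fin m)) :
    charSum lam mu m (S.piecewise x⁻¹ x) = charSum lam mu m x := by
  induction S using Finset.induction_on with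
  | empty => simp
  | insert i S hi ih =>
    have := charSum_update_inv hsub (S.piecewise x⁻¹ x) i
    rw [piecewise_eq_of_notMem _ _ _ hi] at this
    rw [piecewise_insert, ← ih]
    exact this

/-- The sum of `u ^ k` over an inverse pair. -/
def pairSum (u : ℂˣ) (k : ℤ) : ℂ := ((u ^ k : ℂˣ) : ℂ) + ((u ^ (-k) : ℂˣ) : ℂ)

theorem pairSum_neg (u : ℂˣ) (k : ℤ) : pairSum u (-k) = pairSum u k := by
  rw [pairSum, pairSum, neg_neg, add_comm]

theorem pairSum_mul (u : ℂˣ) (k l : ℤ) :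
    pairSum u k * pairSum u l = pairSum u (l + k) + pairSum u (l - k) := by
  simp only [pairSum, neg_add, neg_sub, zpow_add, zpow_sub, zpow_neg, Units.val_mul]
  ring

/-- The sum of the monomial `x ^ α` over the hyperoctahedral group, grouped by permutations. -/
noncomputable def permSum (x : Fin m → ℂˣ) (α : Fin m → ℤ) : ℂ :=
  ∑ π : Equiv.Perm (Fin m), ∏ v, pairSum (x (π v)) (α v)

theorem permSum_comp (x : Fin m → ℂˣ) (α : Fin m → ℤ) (τ : Equiv.Perm (Fin m)) :
    permSum x (α ∘ τ) = permSum x α := by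
  unfold permSum
  refine Fintype.sum_equiv (Equiv.mulRight τ⁻¹) _ _ fun π => ?_
  symm
  rw [← Equiv.prod_comp τ]
  simp

theorem permSum_update_neg (x : Fin m → ℂˣ) (α : Fin m → ℤ) (j : Fin m) (k : ℤ) :
    permSum x (Function.update α j (-k)) = permSum x (Function.update α j k) := by
  unfold permSum
  refine sum_congr rfl fun π _ => prod_congr rfl fun v _ => ?_
  by_cases h : v = j
  · subst h; simp [pairSum_neg]
  · simp [h]

/-- The product of a power sum and an orbit sum, expanded into orbit sums. -/
theorem sum_pairSum_mul_permSum (x : Fin m → ℂˣ) (α : Fin m → ℤ) (k : ℤ) :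
    (∑ s, pairSum (x s) k) * permSum x α =
      ∑ j, (permSum x (Function.update α j (α j + k)) +
        permSum x (Function.update α j (α j - k))) := by
  have h1 : ∀ (π : Equiv.Perm (Fin m)) (j : Fin m) (l : ℤ),
      ∏ v, pairSum (x (π v)) (Function.update α j l v) =
        pairSum (x (π j)) l * ∏ v ∈ univ.erase j, pairSum (x (π v)) (α v) := by
    intro π j l
    rw [← mul_prod_erase univ _ (mem_univ j), Function.update_self]
    congr 1
    refine prod_congr rfl fun v hv => ?_
    rw [Function.update_of_ne (ne_of_mem_erase hv)]
  unfold permSum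
  rw [mul_sum]
  simp only [← sum_add_distrib]
  rw [sum_comm]
  refine sum_congr rfl fun π _ => ?_
  rw [← Equiv.sum_comp π, sum_mul]
  refine sum_congr rfl fun j _ => ?_
  rw [h1, h1, ← add_mul, ← pairSum_mul, mul_assoc,
    mul_prod_erase univ (fun v => pairSum (x (π v)) (α v)) (mem_univ j)]

/-- If the odd power sums up to degree `n` vanish, so does every orbit sum of odd degree at most `n`.
The induction is on the number of nonzero exponents: split off one of them, `k`, and expand the
product of the power sum of degree `k` with the remaining orbit sum. -/
theorem permSum_eq_zero {x : Fin m → ℂˣ} {n : ℕ}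
    (hx : ∀ k : ℤ, |k| ≤ n → Odd k → ∑ s, pairSum (x s) k = 0) (α : Fin m → ℤ)
    (hα : ∑ v, |α v| ≤ n) (hodd : Odd (∑ v, α v)) : permSum x α = 0 := by
  obtain ⟨N, hN⟩ : ∃ N, #{v | α v ≠ 0} = N := ⟨_, rfl⟩
  induction N using Nat.strong_induction_on generalizing α with
  | _ N ih =>
    obtain ⟨i, hi⟩ : ∃ i, α i ≠ 0 := by
      by_contra h
      push Not at h
      simp [h] at hodd
    set β := Function.update α i 0 with hβ
    have sum_update : ∀ (γ : Fin m → ℤ) (j : Fin m) (l : ℤ),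
        ∑ v, Function.update γ j l v = ∑ v, γ v - γ j + l := by
      intro γ j l
      rw [← add_sum_erase univ _ (mem_univ j), ← add_sum_erase univ γ (mem_univ j),
        Function.update_self, sum_congr rfl fun v hv => Function.update_of_ne (ne_of_mem_erase hv) _ _]
      ring
    have abs_update : ∀ (γ : Fin m → ℤ) (j : Fin m) (l : ℤ),
        ∑ v, |Function.update γ j l v| = ∑ v, |γ v| - |γ j| + |l| := by
      intro γ j l
      rw [← sum_update (fun v => |γ v|) j |l|]
      refine sum_congr rfl fun v _ => ?_
      by_cases h : v = j
      · subst h; simp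
      · simp [h]
    have hβsum : ∑ v, β v = ∑ v, α v - α i := by rw [hβ, sum_update, add_zero]
    have hβabs : ∑ v, |β v| = ∑ v, |α v| - |α i| := by rw [hβ, abs_update, abs_zero, add_zero]
    have supp : #{v | β v ≠ 0} < N := by
      rw [← hN]
      refine card_lt_card (Finset.ssubset_iff_subset_ne.2 ⟨fun v hv => ?_, fun h => ?_⟩)
      · simp only [mem_filter, mem_univ, true_and] at hv ⊢
        by_cases hvi : v = i
        · subst hvi; exact hi
        · rwa [hβ, Function.update_of_ne hvi] at hv
      · have : i ∈ ({v | α v ≠ 0} : Finset (Fin m)) := by simp [hi]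
        rw [← h] at this
        simp [hβ] at this
    have hik : |α i| ≤ n :=
      (single_le_sum (f := fun v => |α v|) (fun v _ => abs_nonneg _) (mem_univ i)).trans hα
    have lhs : (∑ s, pairSum (x s) (α i)) * permSum x β = 0 := by
      by_cases hk : Odd (α i)
      · rw [hx _ hik hk, zero_mul]
      · rw [ih _ supp β _ _ rfl, mul_zero]
        · have := abs_nonneg (α i)
          omega
        · rw [hβsum]
          exact hodd.sub_even (Int.not_odd_iff_even.1 hk)
    -- Where `β j = 0` the exponent `± α i` fills a free place, which gives back `permSum x α` up to
    -- a permutation; elsewhere the support shrinks and induction applies.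
    have term : ∀ j, permSum x (Function.update β j (β j + α i)) +
        permSum x (Function.update β j (β j - α i)) = if β j = 0 then 2 * permSum x α else 0 := by
      intro j
      split_ifs with hj
      · rw [hj, zero_add, zero_sub, permSum_update_neg, ← two_mul]
        congr 1
        rw [← permSum_comp x α (Equiv.swap i j)]
        congr 1
        funext v
        by_cases hvj : v = j
        · subst hvj; simp
        · rw [Function.update_of_ne hvj, Function.comp_apply]
          by_cases hvi : v = i
          · subst hvi
            rw [Equiv.swap_apply_left, hβ, Function.update_self]
            rw [hβ, Function.update_of_ne (Ne.symm hvj)] at hj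
            exact hj.symm
          · rw [Equiv.swap_apply_of_ne_of_ne hvi hvj, hβ, Function.update_of_ne hvi]
      · have supp' : ∀ l, #{v | Function.update β j l v ≠ 0} < N := by
          intro l
          refine lt_of_le_of_lt (card_le_card fun v hv => ?_) supp
          simp only [mem_filter, mem_univ, true_and] at hv ⊢
          by_cases hvj : v = j
          · subst hvj; exact hj
          · rwa [Function.update_of_ne hvj] at hv
        rw [ih _ (supp' _) _ _ _ rfl, ih _ (supp' _) _ _ _ rfl, add_zero]
        · rw [abs_update, hβabs]
          have := abs_sub (β j) (α i)
          omega
        · rw [sum_update, hβsum]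
          have : ∑ v, α v - α i - β j + (β j - α i) = ∑ v, α v - 2 * α i := by ring
          rw [this]
          exact hodd.sub_even (even_two_mul _)
        · rw [abs_update, hβabs]
          have := abs_add_le (β j) (α i)
          omega
        · rw [sum_update, hβsum]
          have : ∑ v, α v - α i - β j + (β j + α i) = ∑ v, α v := by ring
          rwa [this]
    rw [sum_pairSum_mul_permSum, sum_congr rfl fun j _ => term j, ← sum_filter, sum_const,
      nsmul_eq_mul, mul_eq_zero, mul_eq_zero] at lhs
    rcases lhs with h | h | h
    · exfalso
      rw [Nat.cast_eq_zero, card_eq_zero, filter_eq_empty_iff] at h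
      exact h (mem_univ i) (by simp [hβ])
    · norm_num at h
    · exact h

/-- The character is the average of its conjugates under the hyperoctahedral group, hence a combination
of orbit sums. -/
theorem charSum_eq_zero (hsub : mu ≤ lam) (hodd : Odd #(skewCells lam mu)) {x : Fin m → ℂˣ}
    (hx : ∀ k : ℤ, |k| ≤ #(skewCells lam mu) → Odd k → ∑ s, pairSum (x s) k = 0) :
    charSum lam mu m x = 0 := by
  classical
  have avg : ∑ π : Equiv.Perm (Fin m), ∑ S ∈ (univ : Finset (Fin m)).powerset,
      charSum lam mu m (S.piecewise (x ∘ π)⁻¹ (x ∘ π)) = 0 := by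
    have h1 : ∀ π : Equiv.Perm (Fin m), ∑ S ∈ (univ : Finset (Fin m)).powerset,
        charSum lam mu m (S.piecewise (x ∘ π)⁻¹ (x ∘ π)) =
        ∑ T ∈ SP lam mu m, ∏ v, pairSum (x (π v)) (weight T v) := by
      intro π
      unfold charSum
      rw [sum_comm]
      refine sum_congr rfl fun T _ => ?_
      have : ∀ v, pairSum (x (π v)) (weight T v) =
          ((x (π v) ^ (-weight T v) : ℂˣ) : ℂ) + ((x (π v) ^ weight T v : ℂˣ) : ℂ) :=
        fun v => add_comm _ _
      rw [prod_congr rfl fun v _ => this v, prod_add]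
      refine sum_congr rfl fun S _ => ?_
      rw [prod_letterValue_eq, ← Units.coe_prod, ← Units.coe_prod, ← Units.val_mul]
      congr 1
      have h2 : ∀ v, S.piecewise (x ∘ π)⁻¹ (x ∘ π) v ^ weight T v =
          S.piecewise (fun v => x (π v) ^ (-weight T v)) (fun v => x (π v) ^ weight T v) v := by
        intro v
        by_cases hv : v ∈ S <;> simp [hv]
      rw [prod_congr rfl fun v _ => h2 v, prod_piecewise, univ_inter]
    rw [sum_congr rfl fun π _ => h1 π, sum_comm]
    exact sum_eq_zero fun T _ =>
      permSum_eq_zero hx (weight T) (sum_abs_weight_le T) (odd_sum_weight T hodd)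
  simp only [charSum_inv_on hsub, charSum_perm hsub, sum_const, smul_smul] at avg
  rw [nsmul_eq_mul, mul_eq_zero] at avg
  refine avg.resolve_left ?_
  refine Nat.cast_ne_zero.2 ?_
  exact Nat.mul_ne_zero (card_ne_zero_of_mem (mem_univ 1))
    (card_ne_zero_of_mem (empty_mem_powerset _))

/-! ### Roots of unity -/

theorem pow_ne_one_of_odd {n : ℕ} (hgcd : ∀ p : ℕ, p.Prime → Odd p → p ≤ n → Nat.gcd m p = 1)
    {ω : ℂˣ} (hω : ω ^ (2 * m) = 1) (hne : ω ≠ 1) {k : ℤ} (hk : |k| ≤ n) (hodd : Odd k) :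
    ω ^ k ≠ 1 := by
  -- The order of `ω` would be odd, hence divide `m`, and its least prime factor is at most `n`.
  intro h
  have h1 : orderOf ω ∣ k.natAbs := by
    have := orderOf_dvd_iff_zpow_eq_one.2 h
    exact Int.natCast_dvd.1 this
  have hk' : Odd k.natAbs := Int.natAbs_odd.2 hodd
  have hd : Odd (orderOf ω) := hk'.of_dvd_nat h1
  have h2 : orderOf ω ∣ m :=
    (Nat.Coprime.dvd_mul_left (Nat.coprime_two_right.2 hd)).1 (orderOf_dvd_of_pow_eq_one hω)
  have h3 : orderOf ω ≠ 1 := fun h => hne (orderOf_eq_one_iff.1 h)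
  have hp := Nat.minFac_prime h3
  have hpd := Nat.minFac_dvd (orderOf ω)
  have hle : (orderOf ω).minFac ≤ n := by
    have := Nat.le_of_dvd hk'.pos (hpd.trans h1)
    rw [Int.abs_eq_natAbs] at hk
    omega
  have h4 := hgcd _ hp (hd.of_dvd_nat hpd) hle
  rw [Nat.gcd_eq_right (hpd.trans h2)] at h4
  exact hp.one_lt.ne' h4

/-- With `x_v = ζ ^ (2 v + 1)`, `v` counted from `0`, and `ζ ^ (4 m) = 1`, the value of the letter at
position `a` of the alphabet is `ζ ^ (2 a + 1)`, for barred letters as well. -/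
theorem letterValue_odd_pow {ζ : ℂˣ} (hζ : ζ ^ (4 * m) = 1) (a : Letter m) :
    letterValue (fun v : Fin m => ζ ^ (2 * (v : ℕ) + 1)) a = ζ ^ (2 * (a : ℕ) + 1) := by
  obtain ⟨v, rfl⟩ | ⟨v, rfl⟩ := eq_unbarred_or_barred a
  · rw [letterValue_unbarred]
    rfl
  · rw [letterValue_barred, inv_eq_iff_mul_eq_one, ← pow_add, ← hζ]
    congr 1
    have := v.isLt
    simp only [barred]
    omega

theorem sum_pairSum_odd_pow {ζ : ℂˣ} (hζ : ζ ^ (4 * m) = 1) {k : ℤ} (hk : (ζ ^ 2) ^ k ≠ 1) :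
    ∑ s : Fin m, pairSum (ζ ^ (2 * (s : ℕ) + 1)) k = 0 := by
  have h1 : ∑ s : Fin m, pairSum (ζ ^ (2 * (s : ℕ) + 1)) k =
      ∑ a : Letter m, (((ζ ^ (2 * (a : ℕ) + 1)) ^ k : ℂˣ) : ℂ) := by
    have := prod_letters (M := Multiplicative ℂ) (univ : Finset (Fin m)) univ
      fun a => Multiplicative.ofAdd (((ζ ^ (2 * (a : ℕ) + 1)) ^ k : ℂˣ) : ℂ)
    rw [letters_univ, ← prod_mul_distrib] at this
    have := congrArg Multiplicative.toAdd this
    rw [toAdd_prod, toAdd_prod] at this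
    simp only [toAdd_ofAdd, toAdd_mul] at this
    rw [this]
    refine sum_congr rfl fun v _ => ?_
    rw [← letterValue_odd_pow hζ (barred v), letterValue_barred, inv_zpow', pairSum]
    rfl
  rw [h1, Fin.sum_univ_eq_sum_range fun a => (((ζ ^ (2 * a + 1)) ^ k : ℂˣ) : ℂ)]
  have h2 : ∀ a : ℕ, (((ζ ^ (2 * a + 1)) ^ k : ℂˣ) : ℂ) =
      ((ζ ^ k : ℂˣ) : ℂ) * (((ζ ^ 2) ^ k : ℂˣ) : ℂ) ^ a := by
    intro a
    rw [← Units.val_pow_eq_pow_val, ← Units.val_mul]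
    congr 1
    simp only [← zpow_natCast, ← zpow_mul, ← zpow_add]
    congr 1
    push_cast
    ring
  rw [sum_congr rfl fun a _ => h2 a, ← mul_sum, geom_sum_eq, ← Units.val_pow_eq_pow_val]
  · have : ((ζ ^ 2) ^ k) ^ (2 * m) = 1 := by
      rw [← zpow_natCast, ← zpow_mul, mul_comm, zpow_mul, zpow_natCast, ← pow_mul,
        ← mul_assoc, show 2 * 2 * m = 4 * m by ring, hζ, one_zpow]
    rw [this]
    simp
  · intro h
    exact hk (Units.ext h)

/-- Up to a power of a square root `ζ` of `ω`, the value at `ω` is the character at the odd powers of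
`ζ`, whose odd power sums up to degree `n` are geometric sums over nontrivial roots of unity. -/
theorem sum_pow_pwr_eq_zero (hsub : mu ≤ lam) (hodd : Odd #(skewCells lam mu))
    (hgcd : ∀ p : ℕ, p.Prime → Odd p → p ≤ #(skewCells lam mu) → Nat.gcd m p = 1)
    {ω : ℂ} (hω : ω ^ (2 * m) = 1) (hne : ω ≠ 1) :
    ∑ T ∈ SP lam mu m, ω ^ pwr T = 0 := by
  rcases Nat.eq_zero_or_pos m with rfl | hm
  · obtain ⟨c, hc⟩ := card_pos.1 hodd.pos
    rw [eq_empty_of_forall_notMem (s := SP lam mu 0) fun T _ => (T ⟨c, hc⟩).elim0, sum_empty]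
  obtain ⟨z, hz⟩ := IsAlgClosed.exists_pow_nat_eq ω (n := 2) two_pos
  have hz0 : z ≠ 0 := by
    rintro rfl
    rw [← hz] at hω
    simp [hm.ne'] at hω
  lift z to ℂˣ using hz0.isUnit with ζ
  have hζ : ζ ^ (4 * m) = 1 := by
    refine Units.ext ?_
    rw [← hz, ← pow_mul, ← mul_assoc] at hω
    push_cast
    exact hω
  have hne' : ζ ^ 2 ≠ 1 := by
    intro h
    apply hne
    rw [← hz, ← Units.val_pow_eq_pow_val, h, Units.val_one]
  have hω' : (ζ ^ 2) ^ (2 * m) = 1 := by rw [← pow_mul, ← mul_assoc]; exact hζ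
  have zero := charSum_eq_zero (m := m) hsub hodd (x := fun v => ζ ^ (2 * (v : ℕ) + 1))
    fun k hk hk' => sum_pairSum_odd_pow hζ (pow_ne_one_of_odd hgcd hω' hne' hk hk')
  have term : ∀ T : Filling lam mu m,
      ((∏ c, letterValue (fun v : Fin m => ζ ^ (2 * (v : ℕ) + 1)) (T c) : ℂˣ) : ℂ) =
      ω ^ pwr T * (ζ : ℂ) ^ #(skewCells lam mu) := by
    intro T
    have h1 : ω ^ pwr T = ∏ c, ω ^ (T c : ℕ) := by
      rw [prod_filling_eq T fun a => ω ^ (a : ℕ), pwr, ← prod_pow_eq_pow_sum]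
      refine prod_congr rfl fun v _ => ?_
      rw [pow_add, ← pow_mul, ← pow_mul]
      congr 3
      have := v.isLt
      simp only [barred]
      omega
    have h2 : (ζ : ℂ) ^ #(skewCells lam mu) = ∏ _c : ↥(skewCells lam mu), (ζ : ℂ) := by
      rw [prod_const, card_univ, Fintype.card_coe]
    rw [h1, h2, ← prod_mul_distrib, Units.coe_prod]
    refine prod_congr rfl fun c _ => ?_
    rw [letterValue_odd_pow hζ, ← hz, pow_succ, pow_mul]
    push_cast
    rfl
  rw [charSum, sum_congr rfl fun T _ => term T, ← sum_mul] at zero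
  exact (mul_eq_zero.1 zero).resolve_right (pow_ne_zero _ ζ.ne_zero)

/-- If an exponential sum vanishes at all nontrivial `M`-th roots of unity, the exponents are
equidistributed modulo `M`. -/
theorem mul_card_filter_eq_card {ι : Type*} (S : Finset ι) (e : ι → ℕ) {M : ℕ} (hM : 0 < M)
    (h : ∀ ω : ℂ, ω ^ M = 1 → ω ≠ 1 → ∑ i ∈ S, ω ^ e i = 0) {k : ℕ} (hk : k < M) :
    M * #(S.filter fun i => e i % M = k) = #S := by
  obtain ⟨ω, hω⟩ : ∃ ω : ℂ, IsPrimitiveRoot ω M :=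
    ⟨_, Complex.isPrimitiveRoot_exp M hM.ne'⟩
  -- Orthogonality of characters; as `k < M`, the exponent `M - k` stands for `-k`.
  have h1 : ∑ j ∈ range M, ω ^ (j * (M - k)) * ∑ i ∈ S, (ω ^ j) ^ e i = #S := by
    rw [sum_eq_single_of_mem 0 (mem_range.2 hM)]
    · simp
    · intro j hj hj0
      rw [h, mul_zero]
      · rw [← pow_mul, mul_comm, pow_mul, hω.pow_eq_one, one_pow]
      · exact hω.pow_ne_one_of_pos_of_lt hj0 (mem_range.1 hj)
  have h2 : ∑ j ∈ range M, ω ^ (j * (M - k)) * ∑ i ∈ S, (ω ^ j) ^ e i =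
      ∑ i ∈ S, if e i % M = k then (M : ℂ) else 0 := by
    simp only [mul_sum]
    rw [sum_comm]
    refine sum_congr rfl fun i _ => ?_
    have h3 : ∀ j, ω ^ (j * (M - k)) * (ω ^ j) ^ e i = (ω ^ (M - k + e i)) ^ j := by
      intro j
      rw [← pow_mul, ← pow_mul, ← pow_add]
      congr 1
      ring
    have hdvd : M ∣ M - k + e i ↔ e i % M = k := by
      constructor
      · rintro ⟨q, hq⟩
        obtain ⟨q, rfl⟩ : ∃ q', q = q' + 1 :=
          Nat.exists_eq_succ_of_ne_zero (by rintro rfl; omega)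
        have : e i = k + M * q := by
          rw [Nat.mul_succ] at hq
          omega
        rw [this, Nat.add_mul_mod_self_left, Nat.mod_eq_of_lt hk]
      · intro he
        have := Nat.div_add_mod (e i) M
        exact ⟨e i / M + 1, by rw [Nat.mul_succ]; omega⟩
    rw [sum_congr rfl fun j _ => h3 j]
    split_ifs with he
    · rw [(hω.pow_eq_one_iff_dvd _).2 (hdvd.2 he)]
      simp
    · have hne : ω ^ (M - k + e i) ≠ 1 := fun h => he (hdvd.1 ((hω.pow_eq_one_iff_dvd _).1 h))
      rw [geom_sum_eq hne, ← pow_mul, mul_comm, pow_mul, hω.pow_eq_one, one_pow, sub_self, zero_div]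
  rw [h2, ← sum_filter, sum_const, nsmul_eq_mul, mul_comm] at h1
  exact_mod_cast h1

open Polynomial in
theorem X_pow_sub_one_dvd_X_pow_sub (M a : ℕ) :
    (X ^ M - 1 : ℤ[X]) ∣ X ^ a - X ^ (a % M) := by
  have h : (X ^ a - X ^ (a % M) : ℤ[X]) = X ^ (a % M) * ((X ^ M) ^ (a / M) - 1 ^ (a / M)) := by
    rw [one_pow, mul_sub, mul_one, ← pow_mul, ← pow_add, Nat.mod_add_div]
  rw [h]
  exact (sub_dvd_pow_sub_pow _ _ _).mul_left _

end SymplecticTableaux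

theorem theorem5p4 (lam mu : YoungDiagram) (hsub : mu ≤ lam) (m n : ℕ) (hm : 1 ≤ m)
    (hn : (SymplecticTableaux.skewCells lam mu).card = n) (hodd : Odd n)
    (hgcd : ∀ p : ℕ, p.Prime → Odd p → p ≤ n → Nat.gcd m p = 1) :
    2 * m ∣ (SymplecticTableaux.SP lam mu m).card ∧
    (Polynomial.X ^ (2 * m) - 1 : Polynomial ℤ) ∣
      SymplecticTableaux.genPoly lam mu m -
        Polynomial.C (((SymplecticTableaux.SP lam mu m).card / (2 * m) : ℕ) : ℤ) *
          ∑ k ∈ Finset.range (2 * m), (Polynomial.X : Polynomial ℤ) ^ k := by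
  subst hn
  have hM : 0 < 2 * m := by omega
  have fibre : ∀ k, k < 2 * m → 2 * m * ((SymplecticTableaux.SP lam mu m).filter
      fun T => SymplecticTableaux.pwr T % (2 * m) = k).card =
      (SymplecticTableaux.SP lam mu m).card := fun k hk =>
    SymplecticTableaux.mul_card_filter_eq_card _ _ hM
      (fun ω hω hne => SymplecticTableaux.sum_pow_pwr_eq_zero hsub hodd hgcd hω hne) hk
  refine ⟨⟨_, (fibre 0 hM).symm⟩, ?_⟩
  have reduced : Polynomial.C (((SymplecticTableaux.SP lam mu m).card / (2 * m) : ℕ) : ℤ) *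
      ∑ k ∈ Finset.range (2 * m), (Polynomial.X : Polynomial ℤ) ^ k =
      ∑ T ∈ SymplecticTableaux.SP lam mu m,
        Polynomial.X ^ (SymplecticTableaux.pwr T % (2 * m)) := by
    rw [← Finset.sum_fiberwise_of_maps_to (t := Finset.range (2 * m))
      (g := fun T => SymplecticTableaux.pwr T % (2 * m))
      fun T _ => Finset.mem_range.2 (Nat.mod_lt _ hM), Finset.mul_sum]
    refine Finset.sum_congr rfl fun k hk => ?_
    rw [Finset.sum_congr rfl (g := fun _ => (Polynomial.X : Polynomial ℤ) ^ k)
      fun T hT => by rw [(Finset.mem_filter.1 hT).2], Finset.sum_const,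
      ← fibre k (Finset.mem_range.1 hk), Nat.mul_div_cancel_left _ hM]
    simp
  rw [reduced, SymplecticTableaux.genPoly, ← Finset.sum_sub_distrib]
  exact Finset.dvd_sum fun T _ => SymplecticTableaux.X_pow_sub_one_dvd_X_pow_sub _ _
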